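/- **Dynamical localisation along the $x_1$-direction.** Let $b:\mathbb{R}\to\mathbb{R}$ be a unidirectionally constant magnetic field (UMF), that is, $b\in L^1_{\mathrm{loc}}(\mathbb{R})$ and its anti-derivative $a(x_1):=\int_0^{x_1}b(y_1)\,dy_1$ satisfies $$0<\liminf_{|x_1|\to\infty}\frac{|a(x_1)|}{|x_1|}\le\infty\qquad\text{and}\qquad \limsup_{|x_1|\to\infty}\frac{|a(x_1)|}{|x_1|^{\alpha}}<\infty\ \text{ for some }\alpha\ge 1 .$$ On $L^2(\mathbb{R}^2)$ let $Q_1$ and $a(Q_1)$ be the operators of multiplication by $x_1$ and by $a(x_1)$ on their maximal domains, let $P_j=-i\,\partial/\partial x_j$ for $j=1,2$, and let $H(b)$ be the non-negative self-adjoint operator given by the closure of $\tfrac12\big[P_1^2+(P_2-a(Q_1))^2\big]$ defined on the Schwartz space $\mathcal{S}(\mathbb{R}^2)$, where it is essentially self-adjoint. Let $\psi_0\in L^2(\mathbb{R}^2)$ with $\|\psi_0\|=1$ and $$\psi_0\in\mathrm{Dom}(H(b)^{1/2})\cap\mathrm{Dom}(Q_1)\cap\mathrm{Dom}(a(Q_1)),$$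 and put $\psi_t:=e^{-itH(b)}\psi_0$ for $t\in\mathbb{R}$. Then $\psi_t\in\mathrm{Dom}(Q_1)$ for every $t\in\mathbb{R}$, and $$\sup_{t\in\mathbb{R}}\,\|Q_1\psi_t\|<\infty .$$ -/

import Mathlib

open MeasureTheory Filter Topology
open scoped ENNReal SchwartzMap InnerProductSpace

noncomputable section

namespace MagneticField

/-! ### Unidirectionally constant magnetic fields -/

/-- The anti-derivative `a(x₁) = ∫₀^{x₁} b(y₁) dy₁`. -/
def antideriv (b : ℝ → ℝ) (x₁ : ℝ) : ℝ := ∫ y₁ in (0 : ℝ)..x₁, b y₁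

/-- Unidirectionally constant magnetic fields (UMF). The filter `cocompact ℝ` expresses
`|x₁| → ∞`; the upper and lower limits are taken in `[0, ∞]`. -/
structure IsUMF (b : ℝ → ℝ) : Prop where
  locallyIntegrable : LocallyIntegrable b volume
  liminf_pos :
    0 < liminf (fun x₁ : ℝ => ENNReal.ofReal (|antideriv b x₁| / |x₁|)) (cocompact ℝ)
  limsup_lt_top : ∃ α : ℝ, 1 ≤ α ∧
    limsup (fun x₁ : ℝ => ENNReal.ofReal (|antideriv b x₁| / |x₁| ^ α)) (cocompact ℝ) < ∞

/-! ### Unbounded operators on a Hilbert space -/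

section Hilbert

variable {E : Type*} [NormedAddCommGroup E] [InnerProductSpace ℂ E] [CompleteSpace E]

/-- `T` is a non-negative self-adjoint square root of `A`: `T` is self-adjoint,
`⟨x, T x⟩ ≥ 0` on `Dom T`, and `T ∘ T = A` with the natural domain
`{x ∈ Dom T | T x ∈ Dom T}` of `T ∘ T`. -/
structure IsNonnegSqrt (A T : E →ₗ.[ℂ] E) : Prop where
  isSelfAdjoint : IsSelfAdjoint T
  nonneg : ∀ x : T.domain, 0 ≤ (⟪(x : E), T x⟫_ℂ).re
  mem_graph_iff : ∀ x y : E,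
    (x, y) ∈ A.graph ↔ ∃ z : E, (x, z) ∈ T.graph ∧ (z, y) ∈ T.graph

open Classical in
/-- The square root `A^{1/2}` of a non-negative self-adjoint operator `A`
(for other operators, where there is none, the value is the zero operator on `{0}`). -/
def sqrtOp (A : E →ₗ.[ℂ] E) : E →ₗ.[ℂ] E :=
  if h : ∃ T : E →ₗ.[ℂ] E, IsNonnegSqrt A T then h.choose else ⊥

/-- `U` is the strongly continuous one-parameter unitary group generated by `A`, that is
`U t = e^{-itA}`: the limit of `i t⁻¹ (U t x - x)` as `t → 0` exists exactly for `x ∈ Dom A`,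
and it is then `A x`. -/
structure IsUnitaryGroupOf (A : E →ₗ.[ℂ] E) (U : ℝ → E ≃ₗᵢ[ℂ] E) : Prop where
  map_zero : ∀ x : E, U 0 x = x
  map_add : ∀ (s t : ℝ) (x : E), U (s + t) x = U s (U t x)
  continuous : ∀ x : E, Continuous fun t : ℝ => U t x
  mem_graph_iff : ∀ x y : E, (x, y) ∈ A.graph ↔
    Tendsto (fun t : ℝ => (Complex.I / (t : ℂ)) • (U t x - x)) (𝓝[≠] 0) (𝓝 y)

open Classical in
/-- The unitary group `t ↦ e^{-itA}` of a self-adjoint operator `A`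
(for other operators, where there is none, the value is the identity). -/
def unitaryGroup (A : E →ₗ.[ℂ] E) : ℝ → E ≃ₗᵢ[ℂ] E :=
  if h : ∃ U : ℝ → E ≃ₗᵢ[ℂ] E, IsUnitaryGroupOf A U then h.choose
  else fun _ => LinearIsometryEquiv.refl ℂ E

end Hilbert

/-! ### Operators on `L²(ℝ²)` -/

/-- The Hilbert space `L²(ℝ²)` of complex-valued square-integrable functions. -/
abbrev L2Plane : Type := Lp ℂ 2 (volume : Measure (ℝ × ℝ))

/-- Multiplication by a real function `f` on its maximal domain
`{ψ ∈ L²(ℝ²) | f ψ ∈ L²(ℝ²)}`. -/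
def mulOp (f : ℝ × ℝ → ℝ) : L2Plane →ₗ.[ℂ] L2Plane where
  domain :=
    { carrier := {ψ | MemLp (fun x => (f x : ℂ) * ψ x) 2 volume}
      zero_mem' := by
        refine MemLp.ae_eq (f := fun _ => (0 : ℂ)) ?_ MemLp.zero
        filter_upwards [Lp.coeFn_zero ℂ 2 (volume : Measure (ℝ × ℝ))] with x hx
        simp [hx]
      add_mem' := by
        intro ψ φ hψ hφ
        refine MemLp.ae_eq ?_ (MemLp.add hψ hφ)
        filter_upwards [Lp.coeFn_add ψ φ] with x hx
        show (f x : ℂ) * ψ x + (f x : ℂ) * φ x = (f x : ℂ) * (ψ + φ : L2Plane) x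
        rw [hx, Pi.add_apply, mul_add]
      smul_mem' := by
        intro c ψ hψ
        refine MemLp.ae_eq ?_ (MemLp.const_smul hψ c)
        filter_upwards [Lp.coeFn_smul c ψ] with x hx
        simp [hx]
        ring }
  toFun :=
    { toFun := fun ψ => MemLp.toLp (fun x => (f x : ℂ) * (ψ : L2Plane) x) ψ.2
      map_add' := by
        intro ψ φ
        rw [← MemLp.toLp_add]
        refine MemLp.toLp_congr _ _ ?_
        filter_upwards [Lp.coeFn_add (ψ : L2Plane) (φ : L2Plane)] with x hx
        show (f x : ℂ) * ((ψ : L2Plane) + (φ : L2Plane) : L2Plane) x =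
          (f x : ℂ) * (ψ : L2Plane) x + (f x : ℂ) * (φ : L2Plane) x
        rw [hx, Pi.add_apply, mul_add]
      map_smul' := by
        intro c ψ
        simp only [RingHom.id_apply]
        rw [← MemLp.toLp_const_smul]
        refine MemLp.toLp_congr _ _ ?_
        filter_upwards [Lp.coeFn_smul c (ψ : L2Plane)] with x hx
        simp [hx]
        ring }

/-- The position operator `Q₁`. -/
def Q₁ : L2Plane →ₗ.[ℂ] L2Plane := mulOp fun x => x.1

/-- The operator `a(Q₁)`. -/
def aQ₁ (b : ℝ → ℝ) : L2Plane →ₗ.[ℂ] L2Plane := mulOp fun x => antideriv b x.1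

/-- The differential expression `P₁ f = -i ∂f/∂x₁`. -/
def P₁ (f : ℝ × ℝ → ℂ) (x : ℝ × ℝ) : ℂ := -Complex.I * lineDeriv ℝ f x (1, 0)

/-- The differential expression `P₂ f = -i ∂f/∂x₂`. -/
def P₂ (f : ℝ × ℝ → ℂ) (x : ℝ × ℝ) : ℂ := -Complex.I * lineDeriv ℝ f x (0, 1)

/-- The differential expression `(P₂ - a(x₁)) f`. -/
def velocity₂ (b : ℝ → ℝ) (f : ℝ × ℝ → ℂ) (x : ℝ × ℝ) : ℂ :=
  P₂ f x - (antideriv b x.1 : ℂ) * f x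

/-- The differential expression `½ [P₁² + (P₂ - a(x₁))²] f`. -/
def hamiltonianExpr (b : ℝ → ℝ) (f : ℝ × ℝ → ℂ) (x : ℝ × ℝ) : ℂ :=
  (1 / 2) * (P₁ (P₁ f) x + velocity₂ b (velocity₂ b f) x)

/-- On Schwartz functions the expression `½ [P₁² + (P₂ - a(x₁))²]` expands as usual; no
differentiability of `a` is needed. -/
theorem hamiltonianExpr_schwartz (b : ℝ → ℝ) (φ : 𝓢(ℝ × ℝ, ℂ)) (x : ℝ × ℝ) :
    hamiltonianExpr b φ x =
      (1 / 2) * (-(LineDeriv.lineDerivOp ((1, 0) : ℝ × ℝ)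
            (LineDeriv.lineDerivOp ((1, 0) : ℝ × ℝ) φ)) x
        - (LineDeriv.lineDerivOp ((0, 1) : ℝ × ℝ)
            (LineDeriv.lineDerivOp ((0, 1) : ℝ × ℝ) φ)) x
        + 2 * Complex.I * (antideriv b x.1 : ℂ)
            * (LineDeriv.lineDerivOp ((0, 1) : ℝ × ℝ) φ) x
        + (antideriv b x.1 : ℂ) ^ 2 * φ x) := by
  have hd : ∀ (g : 𝓢(ℝ × ℝ, ℂ)) (v : ℝ × ℝ),
      HasLineDerivAt ℝ g ((LineDeriv.lineDerivOp v g) x) x v := by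
    intro g v
    rw [SchwartzMap.lineDerivOp_apply]
    exact (g.differentiableAt.lineDifferentiableAt).hasLineDerivAt
  have h1 : P₁ φ = fun y => -Complex.I * (LineDeriv.lineDerivOp ((1, 0) : ℝ × ℝ) φ) y := by
    funext y
    rw [SchwartzMap.lineDerivOp_apply]
    rfl
  have h2 : velocity₂ b φ = fun y =>
      -Complex.I * (LineDeriv.lineDerivOp ((0, 1) : ℝ × ℝ) φ) y
        - (antideriv b y.1 : ℂ) * φ y := by
    funext y
    rw [SchwartzMap.lineDerivOp_apply]
    rfl
  have e1 : lineDeriv ℝ (P₁ φ) x (1, 0) = -Complex.I *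
      (LineDeriv.lineDerivOp ((1, 0) : ℝ × ℝ)
        (LineDeriv.lineDerivOp ((1, 0) : ℝ × ℝ) φ)) x := by
    rw [h1]
    exact (HasDerivAt.const_mul (-Complex.I)
      (hd (LineDeriv.lineDerivOp ((1, 0) : ℝ × ℝ) φ) (1, 0))).deriv
  have e2 : lineDeriv ℝ (velocity₂ b φ) x (0, 1) = -Complex.I *
      (LineDeriv.lineDerivOp ((0, 1) : ℝ × ℝ)
        (LineDeriv.lineDerivOp ((0, 1) : ℝ × ℝ) φ)) x
      - (antideriv b x.1 : ℂ) * (LineDeriv.lineDerivOp ((0, 1) : ℝ × ℝ) φ) x := by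
    rw [h2]
    have h3 := (HasDerivAt.const_mul (-Complex.I)
      (hd (LineDeriv.lineDerivOp ((0, 1) : ℝ × ℝ) φ) (0, 1))).sub
      (HasDerivAt.const_mul (antideriv b x.1 : ℂ) (hd φ (0, 1)))
    refine Eq.trans ?_ h3.deriv
    unfold lineDeriv
    congr 1
    funext t
    simp
  rw [hamiltonianExpr, P₁, e1, velocity₂, P₂, e2, h2]
  linear_combination (1 / 2) *
    ((LineDeriv.lineDerivOp ((1, 0) : ℝ × ℝ) (LineDeriv.lineDerivOp ((1, 0) : ℝ × ℝ) φ)) x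
      + (LineDeriv.lineDerivOp ((0, 1) : ℝ × ℝ)
          (LineDeriv.lineDerivOp ((0, 1) : ℝ × ℝ) φ)) x) * Complex.I_mul_I

/-- The graph of the operator `½ [P₁² + (P₂ - a(Q₁))²]` on the Schwartz space:
all pairs `(φ, ½ [P₁² + (P₂ - a(x₁))²] φ)` in `L²(ℝ²) × L²(ℝ²)` with `φ` a Schwartz function. -/
def schwartzGraph (b : ℝ → ℝ) : Submodule ℂ (L2Plane × L2Plane) where
  carrier := {p | ∃ φ : 𝓢(ℝ × ℝ, ℂ),
    (p.1 : ℝ × ℝ → ℂ) =ᵐ[volume] φ ∧ (p.2 : ℝ × ℝ → ℂ) =ᵐ[volume] hamiltonianExpr b φ}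
  zero_mem' := by
    refine ⟨0, ?_, ?_⟩
    · filter_upwards [Lp.coeFn_zero ℂ 2 (volume : Measure (ℝ × ℝ))] with x hx
      simpa using hx
    · filter_upwards [Lp.coeFn_zero ℂ 2 (volume : Measure (ℝ × ℝ))] with x hx
      rw [hamiltonianExpr_schwartz]
      simpa using hx
  add_mem' := by
    rintro p q ⟨φ, hp1, hp2⟩ ⟨χ, hq1, hq2⟩
    refine ⟨φ + χ, ?_, ?_⟩
    · filter_upwards [Lp.coeFn_add p.1 q.1, hp1, hq1] with x hx h1 h2
      rw [Prod.fst_add, hx, Pi.add_apply, h1, h2, add_apply]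
    · filter_upwards [Lp.coeFn_add p.2 q.2, hp2, hq2] with x hx h1 h2
      rw [Prod.snd_add, hx, Pi.add_apply, h1, h2]
      simp only [hamiltonianExpr_schwartz, LineDeriv.lineDerivOp_add, add_apply]
      ring
  smul_mem' := by
    rintro c p ⟨φ, hp1, hp2⟩
    refine ⟨c • φ, ?_, ?_⟩
    · filter_upwards [Lp.coeFn_smul c p.1, hp1] with x hx h1
      rw [Prod.smul_fst, hx, Pi.smul_apply, h1, smul_apply]
    · filter_upwards [Lp.coeFn_smul c p.2, hp2] with x hx h1
      rw [Prod.smul_snd, hx, Pi.smul_apply, h1]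
      simp only [hamiltonianExpr_schwartz, LineDeriv.lineDerivOp_smul, smul_apply,
        smul_eq_mul]
      ring

/-- `schwartzGraph b` is indeed the graph of a linear operator. -/
theorem schwartzGraph_functional (b : ℝ → ℝ) :
    ∀ p ∈ schwartzGraph b, p.1 = 0 → p.2 = 0 := by
  rintro p ⟨φ, h1, h2⟩ h0
  have hφ : (φ : ℝ × ℝ → ℂ) = fun _ => 0 := by
    refine (Continuous.ae_eq_iff_eq (μ := (volume : Measure (ℝ × ℝ)))
      φ.continuous continuous_const).1 ?_
    rw [h0] at h1
    exact h1.symm.trans (Lp.coeFn_zero ℂ 2 (volume : Measure (ℝ × ℝ)))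
  have hφ0 : φ = 0 := by
    ext x
    simpa using congrFun hφ x
  refine Lp.ext (h2.trans ?_)
  filter_upwards [Lp.coeFn_zero ℂ 2 (volume : Measure (ℝ × ℝ))] with x hx
  rw [hx, hamiltonianExpr_schwartz, hφ0]
  simp

/-- The operator `½ [P₁² + (P₂ - a(Q₁))²]` on the Schwartz space `𝓢(ℝ²)`. -/
def hamiltonianSchwartz (b : ℝ → ℝ) : L2Plane →ₗ.[ℂ] L2Plane :=
  (schwartzGraph b).toLinearPMap

/-- The Hamiltonian `H(b)`: the closure of `½ [P₁² + (P₂ - a(Q₁))²]` on the Schwartz space,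
on which this operator is essentially self-adjoint if `b` is a UMF. -/
def hamiltonian (b : ℝ → ℝ) : L2Plane →ₗ.[ℂ] L2Plane :=
  (hamiltonianSchwartz b).closure

/-- The time evolution `ψ_t = e^{-itH(b)} ψ₀`. -/
def evolve (b : ℝ → ℝ) (t : ℝ) (ψ₀ : L2Plane) : L2Plane :=
  unitaryGroup (hamiltonian b) t ψ₀

end MagneticField

end

/-!
The momentum `P₂` commutes with `H(b)`, because the field depends on `x₁` only, and the kinetic
energy `½ (P₂ - a(Q₁))²` is bounded by the conserved total energy `H(b)`. Hence both terms of
`a(Q₁) ψ_t = P₂ ψ_t - (P₂ - a(Q₁)) ψ_t` are bounded in `L²` uniformly in `t`; at `t = 0` the first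
one is finite because `(P₂ - a(Q₁)) ψ₀` and `a(Q₁) ψ₀` are. As `|x₁| ≤ R + C |a(x₁)|` by the lower
growth condition on `a`, the vectors `Q₁ ψ_t` are bounded as well.

No weak derivatives are used. A vector `ψ` lies in the domain of a self-adjoint operator `D`, with
`‖D ψ‖ ≤ K`, if and only if `‖e^{isD} ψ - ψ‖ ≤ s K` for all `s > 0`, and the argument is carried out
with these Lipschitz bounds for three explicit families of isometries: the translations `shift` for
`D = P₂`, the magnetic translations `magShift` for `D = P₂ - a(Q₁)`, and multiplication by
`e^{i s a(x₁)}`, a `phase`, for `D = a(Q₁)`. They are related by `phase_magShift`.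

* On Schwartz functions the energy bound `norm_velocity₂_sq_le` is an integration by parts, and
  `norm_magShift_sub_le` turns it into a Lipschitz bound for the magnetic translations; this bound
  passes to the closure `H(b)` in `norm_magShift_sub_sq_le`.
* Vectors of `Dom H(b)^{1/2}` are approximated by vectors of `Dom H(b)` without increasing the
  energy (`IsNonnegSqrt.exists_approx`), so the orbit of `ψ₀` satisfies the same bound
  (`norm_magShift_orbit_sub_le`).
* `H(b)` is invariant under `shift` (`shift_hamiltonian`), hence so is `e^{-itH(b)}`, by uniqueness
  for the Schrödinger equation (`IsUnitaryGroupOf.comm_isometry`).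
* Fatou's lemma recovers `a(Q₁) ψ_t ∈ L²` from its Lipschitz bound (`eLpNorm_mul_le_of_phase`).

That `e^{-itH(b)}` exists is a case of Stone's theorem (`IsNonnegSqrt.exists_isUnitaryGroupOf`):
since `Dom H(b)^{1/2}` contains a non-zero vector, `H(b)` has a non-negative self-adjoint square
root, and is therefore self-adjoint itself.
-/

namespace MagneticField

section Hilbert

variable {E : Type*} [NormedAddCommGroup E] [InnerProductSpace ℂ E] {A T : E →ₗ.[ℂ] E}

/-! ### Unitary groups -/

section Group

variable {U : ℝ → E ≃ₗᵢ[ℂ] E}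

theorem IsUnitaryGroupOf.map_graph (hU : IsUnitaryGroupOf A U) (t : ℝ) {x y : E}
    (hx : (x, y) ∈ A.graph) : (U t x, U t y) ∈ A.graph := by
  rw [hU.mem_graph_iff] at hx ⊢
  have h := ((U t).continuous.tendsto y).comp hx
  refine h.congr fun s => ?_
  simp only [Function.comp_apply, map_smul, map_sub]
  rw [← hU.map_add, ← hU.map_add, add_comm]

/-- The Schrödinger equation for the orbit of a vector of `Dom A`. -/
theorem IsUnitaryGroupOf.hasDerivAt (hU : IsUnitaryGroupOf A U) {x y : E}
    (hx : (x, y) ∈ A.graph) (t : ℝ) :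
    HasDerivAt (fun s => U s x) (-Complex.I • U t y) t := by
  rw [hasDerivAt_iff_tendsto_slope_zero]
  have h := ((hU.mem_graph_iff _ _).1 (hU.map_graph t hx)).const_smul (-Complex.I)
  refine h.congr fun s => ?_
  rw [smul_smul, add_comm t s, hU.map_add]
  have : -Complex.I * (Complex.I / (s : ℂ)) = ((s⁻¹ : ℝ) : ℂ) := by
    rw [neg_mul, ← mul_div_assoc, Complex.I_mul_I]
    push_cast
    ring
  rw [this, Complex.coe_smul]

/-- Solutions of `i u' = A u` with `A` symmetric have constant norm. -/
theorem norm_eq_of_schroedinger (hA : ∀ x y : E, (x, y) ∈ A.graph → ⟪y, x⟫_ℂ = ⟪x, y⟫_ℂ)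
    {u v : ℝ → E} (huv : ∀ t, (u t, v t) ∈ A.graph)
    (hu : ∀ t, HasDerivAt u (-Complex.I • v t) t) (t : ℝ) : ‖u t‖ = ‖u 0‖ := by
  have hd : ∀ t, HasDerivAt (fun s => ⟪u s, u s⟫_ℂ) 0 t := by
    intro t
    have h := (hu t).inner ℂ (hu t)
    have h0 : ⟪u t, -Complex.I • v t⟫_ℂ + ⟪-Complex.I • v t, u t⟫_ℂ = 0 := by
      rw [inner_smul_left, inner_smul_right, hA _ _ (huv t)]
      simp
    rwa [h0] at h
  have hc := is_const_of_deriv_eq_zero (fun t => (hd t).differentiableAt)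
    (fun t => (hd t).deriv) t 0
  simp only [inner_self_eq_norm_sq_to_K] at hc
  have hc' : ‖u t‖ ^ 2 = ‖u 0‖ ^ 2 := by exact_mod_cast hc
  exact (sq_eq_sq₀ (norm_nonneg _) (norm_nonneg _)).1 hc'

/-- An isometry that leaves a symmetric operator `A` invariant commutes with `e^{-itA}`. -/
theorem IsUnitaryGroupOf.comm_isometry (hU : IsUnitaryGroupOf A U)
    (hA : ∀ x y : E, (x, y) ∈ A.graph → ⟪y, x⟫_ℂ = ⟪x, y⟫_ℂ) (V : E →ₗᵢ[ℂ] E)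
    (hV : ∀ x y : E, (x, y) ∈ A.graph → (V x, V y) ∈ A.graph) {x y : E}
    (hx : (x, y) ∈ A.graph) (t : ℝ) : V (U t x) = U t (V x) := by
  have h := norm_eq_of_schroedinger hA (u := fun t => V (U t x) - U t (V x))
    (v := fun t => V (U t y) - U t (V y))
    (fun t => A.graph.sub_mem (hV _ _ (hU.map_graph t hx)) (hU.map_graph t (hV _ _ hx)))
    (fun t => by
      have h1 : HasDerivAt (fun t => V (U t x)) (V (-Complex.I • U t y)) t :=
        (V.toContinuousLinearMap.restrictScalars ℝ).hasFDerivAt.comp_hasDerivAt t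
          (hU.hasDerivAt hx t)
      have h2 := h1.sub (hU.hasDerivAt (hV _ _ hx) t)
      rwa [map_smul, ← smul_sub] at h2) t
  simpa [hU.map_zero, sub_eq_zero] using h

end Group

/-! ### Self-adjoint operators and their square roots -/

/-- `‖x + i ε T x‖² = ‖x‖² + ε² ‖T x‖²` for symmetric `T`. -/
theorem norm_add_I_smul_sq {x y : E} (h : ⟪y, x⟫_ℂ = ⟪x, y⟫_ℂ) (ε : ℝ) :
    ‖x + (Complex.I * ε) • y‖ ^ 2 = ‖x‖ ^ 2 + ε ^ 2 * ‖y‖ ^ 2 := by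
  have him : (⟪x, y⟫_ℂ).im = 0 := by
    have h2 := inner_conj_symm (𝕜 := ℂ) x y
    rw [h] at h2
    exact Complex.conj_eq_iff_im.1 h2
  rw [norm_add_sq (𝕜 := ℂ), inner_smul_right, norm_smul]
  simp [mul_pow, him, -Complex.ofReal_mul]

variable [CompleteSpace E]

/-- A self-adjoint operator is symmetric, and maximal with this property. -/
theorem mem_graph_iff_of_isSelfAdjoint (hT : IsSelfAdjoint T) (x y : E) :
    (x, y) ∈ T.graph ↔ ∀ a b : E, (a, b) ∈ T.graph → ⟪b, x⟫_ℂ = ⟪a, y⟫_ℂ := by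
  have h := LinearPMap.adjoint_graph_eq_graph_adjoint hT.dense_domain
  rw [LinearPMap.isSelfAdjoint_def.1 hT] at h
  conv_lhs => rw [h, Submodule.mem_adjoint_iff]
  simp only [sub_eq_zero]

theorem inner_graph_of_isSelfAdjoint (hT : IsSelfAdjoint T) {x y a b : E}
    (hx : (x, y) ∈ T.graph) (ha : (a, b) ∈ T.graph) : ⟪b, x⟫_ℂ = ⟪a, y⟫_ℂ :=
  (mem_graph_iff_of_isSelfAdjoint hT x y).1 hx a b ha

/-- The range of `1 + i ε T` is the whole space: it is closed because `1 + i ε T` is bounded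
below and `T` is closed, and its orthogonal complement is the kernel of `1 - i ε T`. -/
theorem exists_resolvent (hT : IsSelfAdjoint T) {ε : ℝ} (hε : ε ≠ 0) (ψ : E) :
    ∃ φ η : E, (φ, η) ∈ T.graph ∧ φ + (Complex.I * ε) • η = ψ := by
  let f : E × E →L[ℂ] E :=
    ContinuousLinearMap.fst ℂ E E + (Complex.I * ε : ℂ) • ContinuousLinearMap.snd ℂ E E
  have hsym : ∀ p ∈ T.graph, ‖f p‖ ^ 2 = ‖p.1‖ ^ 2 + ε ^ 2 * ‖p.2‖ ^ 2 := fun p hp =>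
    norm_add_I_smul_sq (inner_graph_of_isSelfAdjoint hT hp hp) ε
  let g : T.graph →L[ℂ] E := f.comp T.graph.subtypeL
  have hcl : IsClosed (T.graph : Set (E × E)) := hT.isClosed
  have : CompleteSpace T.graph := hcl.completeSpace_coe
  have hbelow : ∀ p : T.graph, ‖p‖ ≤ (1 + |ε|⁻¹) * ‖g p‖ := by
    intro p
    have h := hsym p p.2
    have h0 : 0 < |ε| := abs_pos.2 hε
    have h1 : ‖(p : E × E).1‖ ≤ ‖g p‖ := by
      refine abs_le_of_sq_le_sq' ?_ (norm_nonneg _) |>.2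
      change _ ≤ ‖f p‖ ^ 2
      rw [h]; nlinarith [mul_nonneg (sq_nonneg ε) (sq_nonneg ‖(p : E × E).2‖)]
    have h2 : |ε| * ‖(p : E × E).2‖ ≤ ‖g p‖ := by
      refine abs_le_of_sq_le_sq' ?_ (norm_nonneg _) |>.2
      change _ ≤ ‖f p‖ ^ 2
      rw [h, mul_pow, sq_abs]; nlinarith [sq_nonneg ‖(p : E × E).1‖]
    have h3 : ‖(p : E × E).2‖ ≤ |ε|⁻¹ * ‖g p‖ := by
      rw [inv_mul_eq_div, le_div_iff₀ h0]; linarith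
    have h4 : 0 ≤ |ε|⁻¹ * ‖g p‖ := by positivity
    refine max_le (h1.trans ?_) (h3.trans ?_) <;> nlinarith [norm_nonneg (g p)]
  have hanti : AntilipschitzWith (Real.toNNReal (1 + |ε|⁻¹)) g := by
    refine AddMonoidHomClass.antilipschitz_of_bound g fun p => ?_
    rw [Real.coe_toNNReal _ (by positivity)]
    exact hbelow p
  have hrange : IsClosed (g.range : Set E) := by
    rw [LinearMap.coe_range]
    exact hanti.isClosed_range g.uniformContinuous
  have htop : g.range = ⊤ := by
    have : CompleteSpace g.range := hrange.completeSpace_coe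
    rw [← Submodule.orthogonal_eq_bot_iff, Submodule.eq_bot_iff]
    intro y hy
    have hy' : ∀ a b : E, (a, b) ∈ T.graph → ⟪a + (Complex.I * ε) • b, y⟫_ℂ = 0 :=
      fun a b hab => (Submodule.mem_orthogonal _ _).1 hy _ ⟨⟨(a, b), hab⟩, rfl⟩
    have hε' : (ε : ℂ) ≠ 0 := Complex.ofReal_ne_zero.2 hε
    have hne : Complex.I * (ε : ℂ) ≠ 0 := mul_ne_zero Complex.I_ne_zero hε'
    have hmem : (y, (Complex.I * ε)⁻¹ • y) ∈ T.graph := by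
      rw [mem_graph_iff_of_isSelfAdjoint hT]
      intro a b hab
      have h := hy' a b hab
      rw [inner_add_left, inner_smul_left] at h
      have hc : (starRingEnd ℂ) (Complex.I * ε) = -(Complex.I * ε) := by simp
      rw [hc] at h
      rw [inner_smul_right, eq_inv_mul_iff_mul_eq₀ hne]
      linear_combination -h
    have h := norm_add_I_smul_sq (inner_graph_of_isSelfAdjoint hT hmem hmem) (-ε)
    have h0 : y + (Complex.I * ((-ε : ℝ) : ℂ)) • (Complex.I * (ε : ℂ))⁻¹ • y = 0 := by
      rw [smul_smul, Complex.ofReal_neg, mul_neg, neg_mul, mul_inv_cancel₀ hne]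
      simp
    rw [h0] at h
    have : ‖y‖ ^ 2 = 0 := by
      have := mul_nonneg (sq_nonneg (-ε)) (sq_nonneg ‖(Complex.I * (ε : ℂ))⁻¹ • y‖)
      simp only [norm_zero] at h
      nlinarith [sq_nonneg ‖y‖]
    simpa using this
  obtain ⟨p, hp⟩ : ψ ∈ g.range := htop ▸ Submodule.mem_top
  exact ⟨p.1.1, p.1.2, p.2, hp⟩

theorem IsNonnegSqrt.symm (h : IsNonnegSqrt A T) {x y x' y' : E}
    (hx : (x, y) ∈ A.graph) (hx' : (x', y') ∈ A.graph) : ⟪y, x'⟫_ℂ = ⟪x, y'⟫_ℂ := by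
  obtain ⟨z, hz, hzy⟩ := (h.mem_graph_iff x y).1 hx
  obtain ⟨z', hz', hzy'⟩ := (h.mem_graph_iff x' y').1 hx'
  rw [inner_graph_of_isSelfAdjoint h.isSelfAdjoint hz' hzy,
    inner_graph_of_isSelfAdjoint h.isSelfAdjoint hzy' hz]

/-- `Dom A` is a core of `A^{1/2}`: a vector `ψ` of `Dom A^{1/2}` is approximated by
`φ = (1 + i ε A^{1/2})⁻¹ ψ` in `Dom A`, whose energy does not exceed that of `ψ`. -/
theorem IsNonnegSqrt.exists_approx (h : IsNonnegSqrt A T) {ψ ζ : E} (hψ : (ψ, ζ) ∈ T.graph)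
    {ε : ℝ} (hε : 0 < ε) :
    ∃ φ y : E, (φ, y) ∈ A.graph ∧ ‖φ - ψ‖ ≤ ε * ‖ζ‖ ∧ (⟪φ, y⟫_ℂ).re ≤ ‖ζ‖ ^ 2 := by
  have hsa := h.isSelfAdjoint
  obtain ⟨φ, η, hφ, hsum⟩ := exists_resolvent hsa hε.ne' ψ
  have hne : Complex.I * (ε : ℂ) ≠ 0 :=
    mul_ne_zero Complex.I_ne_zero (Complex.ofReal_ne_zero.2 hε.ne')
  have hη : (η, (Complex.I * (ε : ℂ))⁻¹ • (ζ - η)) ∈ T.graph := by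
    have h1 := T.graph.smul_mem (Complex.I * (ε : ℂ))⁻¹ (T.graph.sub_mem hψ hφ)
    have h2 : ψ - φ = (Complex.I * (ε : ℂ)) • η := by rw [← hsum]; abel
    simpa [h2, smul_smul, inv_mul_cancel₀ hne, -mul_inv_rev] using h1
  set y := (Complex.I * (ε : ℂ))⁻¹ • (ζ - η) with hy
  have hζ : η + (Complex.I * (ε : ℂ)) • y = ζ := by
    rw [hy, smul_smul, mul_inv_cancel₀ hne, one_smul]; abel
  have hnorm : ‖η‖ ≤ ‖ζ‖ := by
    have h1 := norm_add_I_smul_sq (inner_graph_of_isSelfAdjoint hsa hη hη) ε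
    rw [hζ] at h1
    refine abs_le_of_sq_le_sq' ?_ (norm_nonneg _) |>.2
    nlinarith [mul_nonneg (sq_nonneg ε) (sq_nonneg ‖y‖)]
  refine ⟨φ, y, (h.mem_graph_iff _ _).2 ⟨η, hφ, hη⟩, ?_, ?_⟩
  · have h2 : φ - ψ = -((Complex.I * (ε : ℂ)) • η) := by rw [← hsum]; abel
    rw [h2, norm_neg, norm_smul]
    simpa [abs_of_pos hε] using mul_le_mul_of_nonneg_left hnorm hε.le
  · rw [← inner_graph_of_isSelfAdjoint hsa hη hφ, inner_self_eq_norm_sq_to_K]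
    have : ((‖η‖ : ℂ) ^ 2).re = ‖η‖ ^ 2 := by rw [← Complex.ofReal_pow, Complex.ofReal_re]
    exact (this.trans_le (pow_le_pow_left₀ (norm_nonneg _) hnorm 2))

theorem IsNonnegSqrt.exists_seq_approx (h : IsNonnegSqrt A T) {ψ ζ : E}
    (hψ : (ψ, ζ) ∈ T.graph) :
    ∃ φ y : ℕ → E, (∀ n, (φ n, y n) ∈ A.graph) ∧ (∀ n, (⟪φ n, y n⟫_ℂ).re ≤ ‖ζ‖ ^ 2) ∧
      Tendsto φ atTop (𝓝 ψ) := by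
  choose φ y h1 h2 h3 using fun n : ℕ =>
    h.exists_approx hψ (Nat.one_div_pos_of_nat (α := ℝ) (n := n))
  refine ⟨φ, y, h1, h3, tendsto_iff_norm_sub_tendsto_zero.2 ?_⟩
  refine squeeze_zero (fun _ => norm_nonneg _) h2 ?_
  simpa using tendsto_one_div_add_atTop_nhds_zero_nat.mul_const ‖ζ‖

end Hilbert

/-! ### Existence of the unitary group -/

section Stone

variable {E : Type*} [NormedAddCommGroup E] [InnerProductSpace ℂ E] [CompleteSpace E]
  {A T : E →ₗ.[ℂ] E}

/-- The unitary group `e^{-itB}` of a bounded self-adjoint operator `B`. -/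
noncomputable def expGroup (B : selfAdjoint (E →L[ℂ] E)) (t : ℝ) : E ≃ₗᵢ[ℂ] E :=
  Unitary.linearIsometryEquiv (selfAdjoint.expUnitary (-(t • B)))

theorem expGroup_add (B : selfAdjoint (E →L[ℂ] E)) (s t : ℝ) (x : E) :
    expGroup B (s + t) x = expGroup B s (expGroup B t x) := by
  have hc : Commute ((-(s • B) : selfAdjoint (E →L[ℂ] E)) : E →L[ℂ] E)
      (-(t • B) : selfAdjoint (E →L[ℂ] E)) := by
    simp only [AddSubgroup.coe_neg, selfAdjoint.val_smul]
    exact (((Commute.refl (B : E →L[ℂ] E)).smul_left s).smul_right t).neg_left.neg_right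
  have he : -((s + t) • B) = -(s • B) + -(t • B) := Subtype.ext <| by
    change -((s + t) • (B : E →L[ℂ] E)) = -(s • (B : E →L[ℂ] E)) + -(t • (B : E →L[ℂ] E))
    rw [add_smul, neg_add]
  rw [expGroup, he, hc.expUnitary_add, map_mul]
  rfl

theorem expGroup_zero (B : selfAdjoint (E →L[ℂ] E)) (x : E) : expGroup B 0 x = x := by
  have he : -((0 : ℝ) • B) = 0 := Subtype.ext <| by
    change -((0 : ℝ) • (B : E →L[ℂ] E)) = 0
    rw [zero_smul, neg_zero]
  rw [expGroup, he, selfAdjoint.expUnitary_zero, map_one]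
  rfl

theorem expGroup_eq_of_commute {B C : selfAdjoint (E →L[ℂ] E)}
    (h : Commute (B : E →L[ℂ] E) (C : E →L[ℂ] E)) (t : ℝ) (x : E) :
    expGroup B t x = expGroup C t (expGroup (B - C) t x) := by
  have hc : Commute ((-(t • C) : selfAdjoint (E →L[ℂ] E)) : E →L[ℂ] E)
      (-(t • (B - C)) : selfAdjoint (E →L[ℂ] E)) := by
    simp only [AddSubgroup.coe_neg, selfAdjoint.val_smul, AddSubgroup.coe_sub]
    exact (((h.symm.sub_right (Commute.refl _)).smul_left t).smul_right t).neg_left.neg_right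
  have he : -(t • B) = -(t • C) + -(t • (B - C)) := Subtype.ext <| by
    change -(t • (B : E →L[ℂ] E)) =
      -(t • (C : E →L[ℂ] E)) + -(t • ((B : E →L[ℂ] E) - (C : E →L[ℂ] E)))
    rw [smul_sub]
    abel
  rw [expGroup, he, hc.expUnitary_add, map_mul]
  rfl

theorem hasDerivAt_expGroup (B : selfAdjoint (E →L[ℂ] E)) (x : E) (t : ℝ) :
    HasDerivAt (fun s => expGroup B s x)
      (-Complex.I • expGroup B t ((B : E →L[ℂ] E) x)) t := by
  have hexp : ∀ (s : ℝ) (y : E), expGroup B s y =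
      NormedSpace.exp (s • (-Complex.I • (B : E →L[ℂ] E))) y := by
    intro s y
    have h1 : (Complex.I • (-(s • B) : selfAdjoint (E →L[ℂ] E)).val : E →L[ℂ] E) =
        s • (-Complex.I • (B : E →L[ℂ] E)) := by
      simp only [AddSubgroup.coe_neg, selfAdjoint.val_smul, smul_neg, neg_smul]
      rw [smul_comm]
    rw [← h1]
    rfl
  have h := ((ContinuousLinearMap.apply ℂ E x).restrictScalars ℝ).hasFDerivAt.comp_hasDerivAt t
    (hasDerivAt_exp_smul_const (𝕂 := ℝ) (-Complex.I • (B : E →L[ℂ] E)) t)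
  simp only [hexp]
  refine h.congr_deriv ?_
  simp

theorem norm_expGroup_sub_le (B : selfAdjoint (E →L[ℂ] E)) (x : E) (t : ℝ) :
    ‖expGroup B t x - x‖ ≤ |t| * ‖(B : E →L[ℂ] E) x‖ := by
  have h := Convex.norm_image_sub_le_of_norm_hasDerivWithin_le (s := Set.univ)
    (f := fun s => expGroup B s x) (x := (0 : ℝ)) (y := t)
    (fun s _ => (hasDerivAt_expGroup B x s).hasDerivWithinAt)
    (C := ‖(B : E →L[ℂ] E) x‖) (fun s _ => by simp [norm_smul]) convex_univ
    (Set.mem_univ _) (Set.mem_univ _)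
  simpa [expGroup_zero, mul_comm] using h

theorem norm_expGroup_sub_expGroup_le {B C : selfAdjoint (E →L[ℂ] E)}
    (h : Commute (B : E →L[ℂ] E) (C : E →L[ℂ] E)) (x : E) (t : ℝ) :
    ‖expGroup B t x - expGroup C t x‖ ≤
      |t| * ‖(B : E →L[ℂ] E) x - (C : E →L[ℂ] E) x‖ := by
  rw [expGroup_eq_of_commute h, ← map_sub, LinearIsometryEquiv.norm_map]
  exact norm_expGroup_sub_le (B - C) x t

/-- First-order Taylor expansion of `t ↦ e^{-itB} x`, with a remainder controlled by the modulus of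
continuity of the orbit of a vector `z` close to `B x`. -/
theorem norm_expGroup_sub_sub_le (B : selfAdjoint (E →L[ℂ] E)) (x z : E) (t : ℝ) :
    ‖expGroup B t x - x + (t * Complex.I : ℂ) • (B : E →L[ℂ] E) x‖ ≤
      |t| * (2 * ‖(B : E →L[ℂ] E) x - z‖ + |t| * ‖(B : E →L[ℂ] E) z‖) := by
  have hd : ∀ s : ℝ, HasDerivAt
      (fun s : ℝ => expGroup B s x + (s * Complex.I : ℂ) • (B : E →L[ℂ] E) x)
      (-Complex.I • (expGroup B s ((B : E →L[ℂ] E) x) - (B : E →L[ℂ] E) x)) s := by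
    intro s
    have h1 : HasDerivAt (fun s : ℝ => (s * Complex.I : ℂ) • (B : E →L[ℂ] E) x)
        (Complex.I • (B : E →L[ℂ] E) x) s := by
      simpa using (((hasDerivAt_id s).ofReal_comp).mul_const Complex.I).smul_const
        ((B : E →L[ℂ] E) x)
    refine ((hasDerivAt_expGroup B x s).add h1).congr_deriv ?_
    rw [smul_sub, neg_smul, neg_smul]
    abel
  have h := Convex.norm_image_sub_le_of_norm_hasDerivWithin_le (s := Set.uIcc 0 t)
    (x := (0 : ℝ)) (y := t) (fun s _ => (hd s).hasDerivWithinAt)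
    (C := 2 * ‖(B : E →L[ℂ] E) x - z‖ + |t| * ‖(B : E →L[ℂ] E) z‖) (fun s hs => ?_)
    (convex_uIcc _ _) Set.left_mem_uIcc Set.right_mem_uIcc
  · simp only [expGroup_zero, Complex.ofReal_zero, zero_mul, zero_smul, add_zero, sub_zero,
      Real.norm_eq_abs] at h
    rw [mul_comm |t|]
    refine le_trans (le_of_eq ?_) h
    congr 1
    abel
  · have hs' : |s| ≤ |t| := by simpa using Set.abs_sub_left_of_mem_uIcc hs
    rw [norm_smul, norm_neg, Complex.norm_I, one_mul]
    have e1 : expGroup B s ((B : E →L[ℂ] E) x) - (B : E →L[ℂ] E) x =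
        expGroup B s ((B : E →L[ℂ] E) x - z) + (expGroup B s z - z)
          - ((B : E →L[ℂ] E) x - z) := by
      rw [map_sub]; abel
    have e2 := norm_expGroup_sub_le B z s
    have e3 : |s| * ‖(B : E →L[ℂ] E) z‖ ≤ |t| * ‖(B : E →L[ℂ] E) z‖ := by gcongr
    rw [e1]
    refine (norm_sub_le _ _).trans ?_
    refine (add_le_add_left (norm_add_le _ _) _).trans ?_
    rw [LinearIsometryEquiv.norm_map]
    linarith

/-- If bounded self-adjoint commuting operators `B n` converge strongly to the self-adjoint operator
`A` on `Dom A`, with `‖B n x‖ ≤ ‖A x‖` there, then `A` generates a unitary group, the strong limit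
of the groups `e^{-itB n}`. -/
theorem exists_isUnitaryGroupOf_of_tendsto (hA : IsSelfAdjoint A)
    (B : ℕ → selfAdjoint (E →L[ℂ] E))
    (hcomm : ∀ m n, Commute (B m : E →L[ℂ] E) (B n : E →L[ℂ] E))
    (hle : ∀ n x y, (x, y) ∈ A.graph → ‖(B n : E →L[ℂ] E) x‖ ≤ ‖y‖)
    (hlim : ∀ x y, (x, y) ∈ A.graph →
      Tendsto (fun n => (B n : E →L[ℂ] E) x) atTop (𝓝 y)) :
    ∃ U : ℝ → E ≃ₗᵢ[ℂ] E, IsUnitaryGroupOf A U := by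
  have hdense : ∀ (x : E) (ε : ℝ), 0 < ε → ∃ z w, (z, w) ∈ A.graph ∧ ‖x - z‖ < ε := by
    intro x ε hε
    obtain ⟨z, hz, hxz⟩ := Metric.dense_iff.1 hA.dense_domain x ε hε
    refine ⟨z, A ⟨z, hxz⟩, A.mem_graph ⟨z, hxz⟩, ?_⟩
    rw [← dist_eq_norm, dist_comm]
    exact hz
  have hcauchy : ∀ (t : ℝ) (x : E), CauchySeq fun n => expGroup (B n) t x := by
    intro t x
    rw [Metric.cauchySeq_iff']
    intro ε hε
    obtain ⟨z, w, hzw, hxz⟩ := hdense x (ε / 4) (by linarith)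
    have hB := (hlim z w hzw).cauchySeq
    rw [Metric.cauchySeq_iff'] at hB
    obtain ⟨N, hN⟩ := hB (ε / (4 * (|t| + 1))) (by positivity)
    refine ⟨N, fun n hn => ?_⟩
    have h1 := norm_expGroup_sub_expGroup_le (hcomm n N) z t
    have h2 := hN n hn
    rw [dist_eq_norm] at h2 ⊢
    have h3 : |t| * ‖(B n : E →L[ℂ] E) z - (B N : E →L[ℂ] E) z‖ ≤ ε / 4 := by
      calc |t| * ‖(B n : E →L[ℂ] E) z - (B N : E →L[ℂ] E) z‖
          ≤ (|t| + 1) * (ε / (4 * (|t| + 1))) := by gcongr; linarith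
        _ = ε / 4 := by field_simp
    have e1 : expGroup (B n) t x - expGroup (B N) t x =
        expGroup (B n) t (x - z) + (expGroup (B n) t z - expGroup (B N) t z)
          - expGroup (B N) t (x - z) := by
      rw [map_sub, map_sub]; abel
    rw [e1]
    have h4 := norm_sub_le (expGroup (B n) t (x - z)
      + (expGroup (B n) t z - expGroup (B N) t z)) (expGroup (B N) t (x - z))
    have h5 := norm_add_le (expGroup (B n) t (x - z))
      (expGroup (B n) t z - expGroup (B N) t z)
    rw [LinearIsometryEquiv.norm_map] at h4 h5
    linarith
  choose W hW using fun t x => cauchySeq_tendsto_of_complete (hcauchy t x)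
  have hnorm : ∀ t x, ‖W t x‖ = ‖x‖ := fun t x =>
    tendsto_nhds_unique (hW t x).norm (by simp)
  have hadd : ∀ t x y, W t (x + y) = W t x + W t y := fun t x y =>
    tendsto_nhds_unique (hW t (x + y)) (by simpa using (hW t x).add (hW t y))
  have hsmul : ∀ t (c : ℂ) x, W t (c • x) = c • W t x := fun t c x =>
    tendsto_nhds_unique (hW t (c • x)) (by simpa using (hW t x).const_smul c)
  have hzero : ∀ x, W 0 x = x := fun x =>
    tendsto_nhds_unique (hW 0 x) (by simp [expGroup_zero])
  have hgroup : ∀ s t x, W (s + t) x = W s (W t x) := by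
    intro s t x
    have h1 : Tendsto (fun n => expGroup (B n) s (expGroup (B n) t x - W t x)) atTop (𝓝 0) := by
      rw [tendsto_zero_iff_norm_tendsto_zero]
      simpa only [LinearIsometryEquiv.norm_map] using tendsto_iff_norm_sub_tendsto_zero.1 (hW t x)
    have h2 := h1.add (hW s (W t x))
    rw [zero_add] at h2
    refine tendsto_nhds_unique (hW (s + t) x) (h2.congr fun n => ?_)
    rw [map_sub, sub_add_cancel, expGroup_add]
  let U : ℝ → E ≃ₗᵢ[ℂ] E := fun t =>
    { toFun := W t
      map_add' := hadd t
      map_smul' := hsmul t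
      invFun := W (-t)
      left_inv := fun x => by rw [← hgroup, neg_add_cancel, hzero]
      right_inv := fun x => by rw [← hgroup, add_neg_cancel, hzero]
      norm_map' := hnorm t }
  have hUW : ∀ t x, U t x = W t x := fun _ _ => rfl
  have hlip : ∀ x y, (x, y) ∈ A.graph → ∀ t, ‖U t x - x‖ ≤ |t| * ‖y‖ := by
    intro x y hxy t
    refine le_of_tendsto' ((hW t x).sub_const x).norm fun n => ?_
    exact (norm_expGroup_sub_le (B n) x t).trans
      (mul_le_mul_of_nonneg_left (hle n x y hxy) (abs_nonneg t))
  have htaylor : ∀ x y, (x, y) ∈ A.graph → ∀ z w, (z, w) ∈ A.graph → ∀ t : ℝ,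
      ‖U t x - x + (t * Complex.I : ℂ) • y‖ ≤ |t| * (2 * ‖y - z‖ + |t| * ‖w‖) := by
    intro x y hxy z w hzw t
    refine le_of_tendsto_of_tendsto'
      (((hW t x).sub_const x).add ((hlim x y hxy).const_smul (t * Complex.I : ℂ))).norm
      (((((hlim x y hxy).sub_const z).norm.const_mul 2).add_const _).const_mul _) fun n => ?_
    refine (norm_expGroup_sub_sub_le (B n) x z t).trans ?_
    have := hle n z w hzw
    gcongr
  have hgen : ∀ x y, (x, y) ∈ A.graph →
      Tendsto (fun t : ℝ => (Complex.I / (t : ℂ)) • (U t x - x)) (𝓝[≠] 0) (𝓝 y) := by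
    intro x y hxy
    rw [Metric.tendsto_nhdsWithin_nhds]
    intro ε hε
    obtain ⟨z, w, hzw, hyz⟩ := hdense y (ε / 4) (by linarith)
    refine ⟨ε / (2 * (‖w‖ + 1)), by positivity, fun t ht htd => ?_⟩
    have ht0 : (t : ℂ) ≠ 0 := Complex.ofReal_ne_zero.2 ht
    have htpos : 0 < |t| := abs_pos.2 ht
    rw [dist_zero_right, Real.norm_eq_abs] at htd
    have e1 : (Complex.I / (t : ℂ)) • (U t x - x) - y =
        (Complex.I / (t : ℂ)) • (U t x - x + (t * Complex.I : ℂ) • y) := by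
      have : Complex.I / (t : ℂ) * (t * Complex.I) = -1 := by
        field_simp
        exact Complex.I_sq
      rw [smul_add, smul_smul, this, neg_one_smul, sub_eq_add_neg]
    rw [dist_eq_norm, e1, norm_smul, norm_div, Complex.norm_I, Complex.norm_real,
      Real.norm_eq_abs]
    have h1 := htaylor x y hxy z w hzw t
    have h2 : |t| * ‖w‖ ≤ ε / 2 := by
      calc |t| * ‖w‖ ≤ ε / (2 * (‖w‖ + 1)) * (‖w‖ + 1) := by gcongr; linarith
        _ = ε / 2 := by field_simp
    calc 1 / |t| * ‖U t x - x + (t * Complex.I : ℂ) • y‖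
        ≤ 1 / |t| * (|t| * (2 * ‖y - z‖ + |t| * ‖w‖)) := by gcongr
      _ = 2 * ‖y - z‖ + |t| * ‖w‖ := by field_simp
      _ < ε := by linarith
  refine ⟨U, hzero, hgroup, fun x => ?_, fun x y => ⟨hgen x y, fun hxy => ?_⟩⟩
  · -- By the group law, `‖U t x - U s x‖ = ‖U (t - s) x - x‖`.
    rw [Metric.continuous_iff]
    intro s ε hε
    obtain ⟨z, w, hzw, hxz⟩ := hdense x (ε / 4) (by linarith)
    refine ⟨ε / (2 * (‖w‖ + 1)), by positivity, fun t htd => ?_⟩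
    rw [dist_eq_norm, Real.norm_eq_abs] at htd
    have e0 : U t x = U s (U (t - s) x) := by
      rw [hUW, hUW, hUW, ← hgroup, add_sub_cancel]
    rw [dist_eq_norm, e0, ← map_sub, LinearIsometryEquiv.norm_map]
    have e1 : U (t - s) x - x = U (t - s) (x - z) + (U (t - s) z - z) - (x - z) := by
      rw [map_sub]; abel
    have h1 := hlip z w hzw (t - s)
    have h2 : |t - s| * ‖w‖ ≤ ε / 2 := by
      calc |t - s| * ‖w‖ ≤ ε / (2 * (‖w‖ + 1)) * (‖w‖ + 1) := by gcongr; linarith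
        _ = ε / 2 := by field_simp
    rw [e1]
    have h4 := norm_sub_le (U (t - s) (x - z) + (U (t - s) z - z)) (x - z)
    have h5 := norm_add_le (U (t - s) (x - z)) (U (t - s) z - z)
    rw [LinearIsometryEquiv.norm_map] at h5
    linarith
  · -- The generator is symmetric and extends `A`, hence is `A` by maximality.
    rw [mem_graph_iff_of_isSelfAdjoint hA]
    intro a c hac
    have hneg : Tendsto (fun t : ℝ => -t) (𝓝[≠] 0) (𝓝[≠] 0) := by
      refine tendsto_nhdsWithin_iff.2 ⟨?_, ?_⟩
      · have : Tendsto (fun t : ℝ => -t) (𝓝 0) (𝓝 (-0)) := tendsto_id.neg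
        rw [neg_zero] at this
        exact this.mono_left nhdsWithin_le_nhds
      · filter_upwards [self_mem_nhdsWithin] with t ht
        simpa using ht
    have h1 := (hgen a c hac).inner (𝕜 := ℂ) (tendsto_const_nhds (x := x))
    have h2 := (tendsto_const_nhds (x := a)).inner (𝕜 := ℂ) (hxy.comp hneg)
    refine tendsto_nhds_unique h1 (h2.congr fun t => ?_)
    have h3 : ⟪U t a, x⟫_ℂ = ⟪a, U (-t) x⟫_ℂ := by
      rw [← LinearIsometryEquiv.inner_map_map (U t) a, hUW t (U (-t) x), hUW (-t), ← hgroup,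
        add_neg_cancel, hzero]
    simp only [Function.comp_apply]
    rw [inner_smul_left, inner_smul_right, inner_sub_left, inner_sub_right, h3, map_div₀,
      Complex.conj_I, Complex.conj_ofReal, Complex.ofReal_neg, div_neg, neg_div]

/-! ### Self-adjointness from a square root, and Stone's theorem -/

theorem IsNonnegSqrt.exists_add_smul (h : IsNonnegSqrt A T) {ε : ℝ} (hε : ε ≠ 0) (ψ : E) :
    ∃ φ y : E, (φ, y) ∈ A.graph ∧ φ + ((ε ^ 2 : ℝ) : ℂ) • y = ψ := by
  -- Factorize `1 + ε² A = (1 - i ε T) (1 + i ε T)`.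
  obtain ⟨φ₁, η₁, h1, e1⟩ := exists_resolvent h.isSelfAdjoint (neg_ne_zero.2 hε) ψ
  obtain ⟨φ, η, h2, e2⟩ := exists_resolvent h.isSelfAdjoint hε φ₁
  have hne : Complex.I * (ε : ℂ) ≠ 0 :=
    mul_ne_zero Complex.I_ne_zero (Complex.ofReal_ne_zero.2 hε)
  have e3 : φ₁ - φ = (Complex.I * (ε : ℂ)) • η := by rw [← e2]; abel
  have hη : (η, (Complex.I * (ε : ℂ))⁻¹ • (η₁ - η)) ∈ T.graph := by
    have h3 := T.graph.smul_mem (Complex.I * (ε : ℂ))⁻¹ (T.graph.sub_mem h1 h2)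
    simpa [e3, smul_smul, inv_mul_cancel₀ hne, -mul_inv_rev] using h3
  refine ⟨φ, _, (h.mem_graph_iff _ _).2 ⟨η, h2, hη⟩, ?_⟩
  have e4 : ((ε ^ 2 : ℝ) : ℂ) * (Complex.I * (ε : ℂ))⁻¹ = -(Complex.I * ε) := by
    rw [← div_eq_mul_inv, div_eq_iff hne]
    push_cast
    linear_combination (ε : ℂ) ^ 2 * Complex.I_mul_I
  rw [smul_smul, e4, ← e1, smul_sub, neg_smul, neg_smul, ← e3, Complex.ofReal_neg, mul_neg,
    neg_smul]
  abel

theorem IsNonnegSqrt.inner_nonneg (h : IsNonnegSqrt A T) {x y : E} (hx : (x, y) ∈ A.graph) :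
    0 ≤ (⟪x, y⟫_ℂ).re := by
  obtain ⟨z, hz, hzy⟩ := (h.mem_graph_iff x y).1 hx
  rw [← inner_graph_of_isSelfAdjoint h.isSelfAdjoint hzy hz]
  exact inner_self_nonneg (𝕜 := ℂ)

theorem IsNonnegSqrt.norm_le (h : IsNonnegSqrt A T) {x y : E} (hx : (x, y) ∈ A.graph) {δ : ℝ}
    (hδ : 0 ≤ δ) : ‖x‖ ≤ ‖x + (δ : ℂ) • y‖ := by
  have h1 : ‖x‖ ^ 2 ≤ ‖x‖ * ‖x + (δ : ℂ) • y‖ := by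
    calc ‖x‖ ^ 2 ≤ (⟪x, x + (δ : ℂ) • y⟫_ℂ).re := by
          rw [inner_add_right, inner_smul_right, Complex.add_re, Complex.re_ofReal_mul]
          have h2 : (⟪x, x⟫_ℂ).re = ‖x‖ ^ 2 := inner_self_eq_norm_sq (𝕜 := ℂ) x
          rw [h2]
          linarith [mul_nonneg hδ (h.inner_nonneg hx)]
      _ ≤ ‖⟪x, x + (δ : ℂ) • y⟫_ℂ‖ := Complex.re_le_norm _
      _ ≤ _ := norm_inner_le_norm _ _
  rcases (norm_nonneg x).eq_or_lt with h0 | h0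
  · rw [← h0]; positivity
  · nlinarith

/-- A symmetric operator `A` for which `1 + A` is onto has no proper symmetric extension. -/
theorem IsNonnegSqrt.mem_graph_of_forall (h : IsNonnegSqrt A T) {x y : E}
    (hxy : ∀ a b : E, (a, b) ∈ A.graph → ⟪b, x⟫_ℂ = ⟪a, y⟫_ℂ) : (x, y) ∈ A.graph := by
  obtain ⟨x', y', hx', e⟩ := h.exists_add_smul one_ne_zero (x + y)
  obtain ⟨a, c, hac, e'⟩ := h.exists_add_smul one_ne_zero (x - x')
  simp only [one_pow, Complex.ofReal_one, one_smul] at e e'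
  have h1 : ⟪c, x - x'⟫_ℂ = ⟪a, y - y'⟫_ℂ := by
    rw [inner_sub_right, inner_sub_right, hxy a c hac, h.symm hac hx']
  have h2 : y - y' = -(x - x') := by
    have : y = x' + y' - x := by rw [e]; abel
    rw [this]; abel
  have h3 : ⟪x - x', x - x'⟫_ℂ = 0 := by
    nth_rewrite 1 [← e']
    rw [inner_add_left, h1, h2, inner_neg_right, add_neg_cancel]
  have h4 : x = x' := sub_eq_zero.1 (inner_self_eq_zero.1 h3)
  rw [h4, sub_self, neg_zero, sub_eq_zero] at h2
  rw [h4, h2]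
  exact hx'

theorem IsNonnegSqrt.dense_domain (h : IsNonnegSqrt A T) : Dense (A.domain : Set E) := by
  refine dense_iff_closure_eq.2 (Set.eq_univ_of_univ_subset ?_)
  rw [← h.isSelfAdjoint.dense_domain.closure_eq]
  refine closure_minimal (fun ψ hψ => ?_) isClosed_closure
  obtain ⟨φ, y, h1, -, h3⟩ := h.exists_seq_approx (T.mem_graph ⟨ψ, hψ⟩)
  exact mem_closure_of_tendsto h3
    (Eventually.of_forall fun n => LinearPMap.mem_domain_of_mem_graph (h1 n))

theorem IsNonnegSqrt.isSelfAdjoint_left (h : IsNonnegSqrt A T) : IsSelfAdjoint A := by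
  rw [LinearPMap.isSelfAdjoint_def]
  refine LinearPMap.eq_of_eq_graph ?_
  rw [LinearPMap.adjoint_graph_eq_graph_adjoint h.dense_domain]
  ext ⟨x, y⟩
  simp only [Submodule.mem_adjoint_iff, sub_eq_zero]
  exact ⟨h.mem_graph_of_forall, fun hx a c hac => h.symm hac hx⟩

/-- The resolvent `(1 + δ A)⁻¹` as a bounded operator. -/
theorem IsNonnegSqrt.exists_resolvent_clm (h : IsNonnegSqrt A T) {δ : ℝ} (hδ : 0 < δ) :
    ∃ J : E →L[ℂ] E, (∀ x y, (x, y) ∈ A.graph → J (x + (δ : ℂ) • y) = x) ∧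
      (∀ ψ, (J ψ, (δ : ℂ)⁻¹ • (ψ - J ψ)) ∈ A.graph) ∧ ∀ ψ, ‖J ψ‖ ≤ ‖ψ‖ := by
  have hδ' : (δ : ℂ) ≠ 0 := Complex.ofReal_ne_zero.2 hδ.ne'
  choose J Y hJ e using fun ψ : E => h.exists_add_smul (Real.sqrt_pos.2 hδ).ne' ψ
  rw [Real.sq_sqrt hδ.le] at e
  have huniq : ∀ x y, (x, y) ∈ A.graph → J (x + (δ : ℂ) • y) = x := by
    intro x y hxy
    have h1 := h.norm_le (A.graph.sub_mem (hJ (x + (δ : ℂ) • y)) hxy) hδ.le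
    have h2 : J (x + (δ : ℂ) • y) - x + (δ : ℂ) • (Y (x + (δ : ℂ) • y) - y) = 0 := by
      rw [smul_sub, sub_add_sub_comm, e, sub_self]
    change ‖J (x + (δ : ℂ) • y) - x‖ ≤
      ‖J (x + (δ : ℂ) • y) - x + (δ : ℂ) • (Y (x + (δ : ℂ) • y) - y)‖ at h1
    rw [h2, norm_zero] at h1
    exact sub_eq_zero.1 (norm_le_zero_iff.1 h1)
  have hY : ∀ ψ, (δ : ℂ)⁻¹ • (ψ - J ψ) = Y ψ := by
    intro ψ
    have h1 : ψ - J ψ = (δ : ℂ) • Y ψ := by rw [sub_eq_iff_eq_add, add_comm, e]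
    rw [h1, smul_smul, inv_mul_cancel₀ hδ', one_smul]
  have hnorm : ∀ ψ, ‖J ψ‖ ≤ ‖ψ‖ := by
    intro ψ
    have h1 := h.norm_le (hJ ψ) hδ.le
    rwa [e] at h1
  let L : E →ₗ[ℂ] E :=
    { toFun := J
      map_add' := fun ψ φ => by
        have h1 := huniq _ _ (A.graph.add_mem (hJ ψ) (hJ φ))
        rw [← h1]
        congr 1
        change _ = J ψ + J φ + (δ : ℂ) • (Y ψ + Y φ)
        rw [smul_add, add_add_add_comm, e, e]
      map_smul' := fun c ψ => by
        have h1 := huniq _ _ (A.graph.smul_mem c (hJ ψ))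
        rw [RingHom.id_apply]
        refine Eq.trans ?_ h1
        congr 1
        change _ = c • J ψ + (δ : ℂ) • (c • Y ψ)
        rw [smul_comm, ← smul_add, e] }
  refine ⟨L.mkContinuous 1 fun ψ => (hnorm ψ).trans_eq (one_mul _).symm, huniq, fun ψ => ?_, hnorm⟩
  change (J ψ, (δ : ℂ)⁻¹ • (ψ - J ψ)) ∈ A.graph
  rw [hY]
  exact hJ ψ

/-- Stone's theorem for an operator with a non-negative self-adjoint square root: the Yosida
approximations `A (1 + A / n)⁻¹` satisfy the hypotheses of
`exists_isUnitaryGroupOf_of_tendsto`. -/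
theorem IsNonnegSqrt.exists_isUnitaryGroupOf (h : IsNonnegSqrt A T) :
    ∃ U : ℝ → E ≃ₗᵢ[ℂ] E, IsUnitaryGroupOf A U := by
  let δ : ℕ → ℝ := fun n => 1 / ((n : ℝ) + 1)
  have hδ : ∀ n, 0 < δ n := fun n => Nat.one_div_pos_of_nat
  have hδ' : ∀ n, (δ n : ℂ) ≠ 0 := fun n => Complex.ofReal_ne_zero.2 (hδ n).ne'
  choose J hJ hJmem hJnorm using fun n => h.exists_resolvent_clm (hδ n)
  -- `J n` maps `Dom A` to itself and commutes with `A` there.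
  have hJgraph : ∀ n x y, (x, y) ∈ A.graph → (J n x, J n y) ∈ A.graph := by
    intro n x y hxy
    have h1 : (δ n : ℂ)⁻¹ • (x - J n x) = J n y := by
      have h2 := hJ n x y hxy
      rw [map_add, map_smul] at h2
      have h3 : x - J n x = (δ n : ℂ) • J n y := by
        rw [sub_eq_iff_eq_add, add_comm]; exact h2.symm
      rw [h3, smul_smul, inv_mul_cancel₀ (hδ' n), one_smul]
    rw [← h1]
    exact hJmem n x
  have hJcomm : ∀ m n ψ, J m (J n ψ) = J n (J m ψ) := by
    intro m n ψ
    have h1 := hJ n _ _ (hJgraph m _ _ (hJmem n ψ))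
    rw [map_smul, map_sub, smul_smul, mul_inv_cancel₀ (hδ' n), one_smul, add_sub_cancel] at h1
    exact h1.symm
  have hJsymm : ∀ n ψ φ, ⟪J n ψ, φ⟫_ℂ = ⟪ψ, J n φ⟫_ℂ := by
    intro n ψ φ
    have h1 := h.symm (hJmem n ψ) (hJmem n φ)
    rw [inner_smul_left, inner_smul_right, map_inv₀, Complex.conj_ofReal] at h1
    have h2 := mul_left_cancel₀ (inv_ne_zero (hδ' n)) h1
    rw [inner_sub_left, inner_sub_right] at h2
    linear_combination -h2
  have hJsa : ∀ n, IsSelfAdjoint (J n) := fun n =>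
    ContinuousLinearMap.isSelfAdjoint_iff_isSymmetric.2 (hJsymm n)
  let B : ℕ → selfAdjoint (E →L[ℂ] E) := fun n =>
    (δ n)⁻¹ • (⟨1 - J n, (IsSelfAdjoint.one _).sub (hJsa n)⟩ : selfAdjoint (E →L[ℂ] E))
  have hBval : ∀ n, (B n : E →L[ℂ] E) = (δ n)⁻¹ • (1 - J n) := fun n => rfl
  have hBJ : ∀ n x y, (x, y) ∈ A.graph → (B n : E →L[ℂ] E) x = J n y := by
    intro n x y hxy
    have h2 := hJ n x y hxy
    rw [map_add, map_smul] at h2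
    have h3 : x - J n x = δ n • J n y := by
      rw [sub_eq_iff_eq_add, add_comm, ← Complex.coe_smul]; exact h2.symm
    change (δ n)⁻¹ • (x - J n x) = J n y
    rw [h3, smul_smul, inv_mul_cancel₀ (hδ n).ne', one_smul]
  refine exists_isUnitaryGroupOf_of_tendsto h.isSelfAdjoint_left B (fun m n => ?_)
    (fun n x y hxy => ?_) fun x y hxy => ?_
  · have hc : Commute (J m) (J n) := ContinuousLinearMap.ext fun ψ => hJcomm m n ψ
    rw [hBval, hBval]
    exact ((((Commute.one_left _).sub_left ((Commute.one_right _).sub_right hc)).smul_left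
      _).smul_right _)
  · rw [hBJ n x y hxy]
    exact hJnorm n y
  · -- `J n` converges strongly to the identity, by density from the bound `‖J n z - z‖ ≤ δ n ‖A z‖`.
    simp only [hBJ _ x y hxy]
    rw [Metric.tendsto_atTop]
    intro ε hε
    obtain ⟨z, hz, hzd⟩ := Metric.dense_iff.1 h.dense_domain y (ε / 4) (by linarith)
    have hgr := A.mem_graph ⟨z, hzd⟩
    set w := A ⟨z, hzd⟩
    rw [Metric.mem_ball, dist_eq_norm] at hz
    have ht : Tendsto (fun n => δ n * ‖w‖) atTop (𝓝 0) := by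
      simpa only [zero_mul] using
        (tendsto_one_div_add_atTop_nhds_zero_nat (𝕜 := ℝ)).mul_const ‖w‖
    obtain ⟨N, hN⟩ := eventually_atTop.1 (ht.eventually_lt_const (by linarith : 0 < ε / 4))
    refine ⟨N, fun n hn => ?_⟩
    have h1 : ‖z - J n z‖ ≤ δ n * ‖w‖ := by
      have h2 := hJ n z w hgr
      rw [map_add, map_smul] at h2
      have h3 : z - J n z = (δ n : ℂ) • J n w := by
        rw [sub_eq_iff_eq_add, add_comm]; exact h2.symm
      rw [h3, norm_smul, Complex.norm_real, Real.norm_of_nonneg (hδ n).le]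
      exact mul_le_mul_of_nonneg_left (hJnorm n w) (hδ n).le
    have e1 : J n y - y = (z - y) - J n (z - y) - (z - J n z) := by rw [map_sub]; abel
    rw [dist_eq_norm, e1]
    have h4 := norm_sub_le ((z - y) - J n (z - y)) (z - J n z)
    have h5 := norm_sub_le (z - y) (J n (z - y))
    have h6 := hJnorm n (z - y)
    have h7 := hN n hn
    linarith

end Stone

/-! ### Growth of the anti-derivative -/

section Antideriv

variable {b : ℝ → ℝ}

theorem IsUMF.continuous_antideriv (hb : IsUMF b) : Continuous (antideriv b) :=
  intervalIntegral.continuous_primitive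
    (fun _ _ => (hb.locallyIntegrable.integrableOn_isCompact isCompact_uIcc).intervalIntegrable) 0

/-- The upper growth condition makes `a` polynomially bounded. -/
theorem IsUMF.exists_antideriv_le (hb : IsUMF b) :
    ∃ (C : ℝ) (k : ℕ), ∀ x, |antideriv b x| ≤ C * (1 + |x|) ^ k := by
  obtain ⟨α, hα, hlim⟩ := hb.limsup_lt_top
  obtain ⟨c, hc, hc'⟩ := exists_between hlim
  have hev := eventually_lt_of_limsup_lt hc
  rw [← coclosedCompact_eq_cocompact, hasBasis_coclosedCompact.eventually_iff] at hev
  obtain ⟨K, ⟨-, hK⟩, hKc⟩ := hev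
  obtain ⟨M, hM⟩ := hK.exists_bound_of_continuousOn hb.continuous_antideriv.continuousOn
  refine ⟨max M c.toReal, ⌈α⌉₊, fun x => ?_⟩
  have h1 : (1 : ℝ) ≤ (1 + |x|) ^ ⌈α⌉₊ := one_le_pow₀ (by linarith [abs_nonneg x])
  have hmax : 0 ≤ max M c.toReal := le_max_of_le_right ENNReal.toReal_nonneg
  by_cases hx : x ∈ K
  · calc |antideriv b x| ≤ max M c.toReal := (hM x hx).trans (le_max_left _ _)
      _ ≤ _ := le_mul_of_one_le_right hmax h1
  · have h2 := hKc hx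
    rw [ENNReal.ofReal_lt_iff_lt_toReal (by positivity) hc'.ne] at h2
    have h3 : |x| ^ α ≤ (1 + |x|) ^ ⌈α⌉₊ := by
      rw [← Real.rpow_natCast]
      calc |x| ^ α ≤ (1 + |x|) ^ α := Real.rpow_le_rpow (abs_nonneg _) (by linarith) (by linarith)
        _ ≤ _ := Real.rpow_le_rpow_of_exponent_le (by linarith [abs_nonneg x]) (Nat.le_ceil α)
    rcases (Real.rpow_nonneg (abs_nonneg x) α).eq_or_lt with h0 | h0
    · -- Here `x = 0`, where `a` vanishes.
      have hx0 : x = 0 := by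
        have := (Real.rpow_eq_zero_iff_of_nonneg (abs_nonneg x)).1 h0.symm
        exact abs_eq_zero.1 this.1
      subst hx0
      simp [antideriv, hmax]
    · rw [div_lt_iff₀ h0] at h2
      calc |antideriv b x| ≤ c.toReal * |x| ^ α := h2.le
        _ ≤ max M c.toReal * (1 + |x|) ^ ⌈α⌉₊ := by
            gcongr
            exact le_max_right _ _

/-- The lower growth condition makes `x₁` bounded by an affine function of `|a(x₁)|`. -/
theorem IsUMF.exists_abs_le (hb : IsUMF b) :
    ∃ R C : ℝ, 0 ≤ R ∧ 0 ≤ C ∧ ∀ x, |x| ≤ R + C * |antideriv b x| := by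
  obtain ⟨c, hc0, hc⟩ := exists_between hb.liminf_pos
  have hev := eventually_lt_of_lt_liminf hc
  rw [← coclosedCompact_eq_cocompact, hasBasis_coclosedCompact.eventually_iff] at hev
  obtain ⟨K, ⟨-, hK⟩, hKc⟩ := hev
  obtain ⟨M, hM⟩ := hK.exists_bound_of_continuousOn continuous_id.continuousOn
  have hct : c ≠ ∞ := (hc.trans_le le_top).ne
  have hcr : 0 < c.toReal := ENNReal.toReal_pos hc0.ne' hct
  refine ⟨max M 0, c.toReal⁻¹, le_max_right _ _, by positivity, fun x => ?_⟩
  by_cases hx : x ∈ K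
  · have h1 : |x| ≤ M := hM x hx
    have h2 : 0 ≤ c.toReal⁻¹ * |antideriv b x| := by positivity
    linarith [le_max_left M 0]
  · have h1 := hKc hx
    rw [ENNReal.lt_ofReal_iff_toReal_lt hct] at h1
    have h2 : |x| ≤ c.toReal⁻¹ * |antideriv b x| := by
      rcases (abs_nonneg x).eq_or_lt with h0 | h0
      · rw [← h0]; positivity
      · rw [lt_div_iff₀ h0] at h1
        rw [inv_mul_eq_div, le_div_iff₀ hcr]
        linarith
    linarith [le_max_right M 0]

end Antideriv

/-! ### Rapidly decreasing functions -/

/-- Continuous functions on the plane that decay faster than any polynomial. Unlike Schwartz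
functions they are stable under multiplication by `a(x₁)`, which is merely continuous. -/
structure RapidDecay (f : ℝ × ℝ → ℂ) : Prop where
  continuous : Continuous f
  decay : ∀ k : ℕ, ∃ C : ℝ, ∀ x, (1 + ‖x‖) ^ k * ‖f x‖ ≤ C

/-- Continuous real functions on the plane of at most polynomial growth. -/
structure PolyGrowth (c : ℝ × ℝ → ℝ) : Prop where
  continuous : Continuous c
  growth : ∃ (C : ℝ) (k : ℕ), ∀ x, |c x| ≤ C * (1 + ‖x‖) ^ k

theorem PolyGrowth.zero : PolyGrowth fun _ => 0 :=
  ⟨continuous_const, 0, 0, fun x => by simp⟩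

theorem IsUMF.polyGrowth {b : ℝ → ℝ} (hb : IsUMF b) :
    PolyGrowth fun x => antideriv b x.1 := by
  refine ⟨hb.continuous_antideriv.comp continuous_fst, ?_⟩
  obtain ⟨C, k, h⟩ := hb.exists_antideriv_le
  have hC : 0 ≤ C := by simpa using (abs_nonneg _).trans (h 0)
  refine ⟨C, k, fun x => (h x.1).trans ?_⟩
  gcongr
  exact norm_fst_le x

namespace RapidDecay

variable {f g : ℝ × ℝ → ℂ}

theorem schwartz (φ : 𝓢(ℝ × ℝ, ℂ)) : RapidDecay φ := by
  refine ⟨φ.continuous, fun k => ?_⟩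
  have h := SchwartzMap.one_add_le_sup_seminorm_apply (𝕜 := ℝ) (m := (k, 0)) (k := k) (n := 0)
    le_rfl le_rfl φ
  simp only [norm_iteratedFDeriv_zero] at h
  exact ⟨_, h⟩

theorem add (hf : RapidDecay f) (hg : RapidDecay g) : RapidDecay fun x => f x + g x := by
  refine ⟨hf.continuous.add hg.continuous, fun k => ?_⟩
  obtain ⟨C, hC⟩ := hf.decay k
  obtain ⟨D, hD⟩ := hg.decay k
  refine ⟨C + D, fun x => ?_⟩
  have h : (1 + ‖x‖) ^ k * ‖f x + g x‖ ≤ (1 + ‖x‖) ^ k * (‖f x‖ + ‖g x‖) := by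
    gcongr; exact norm_add_le _ _
  linarith [hC x, hD x]

theorem const_mul (z : ℂ) (hf : RapidDecay f) : RapidDecay fun x => z * f x := by
  refine ⟨continuous_const.mul hf.continuous, fun k => ?_⟩
  obtain ⟨C, hC⟩ := hf.decay k
  refine ⟨‖z‖ * C, fun x => ?_⟩
  rw [norm_mul, mul_left_comm]
  exact mul_le_mul_of_nonneg_left (hC x) (norm_nonneg _)

theorem conj (hf : RapidDecay f) : RapidDecay fun x => (starRingEnd ℂ) (f x) :=
  ⟨Complex.continuous_conj.comp hf.continuous, fun k => by
    simpa only [RCLike.norm_conj] using hf.decay k⟩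

theorem polyGrowth_mul {c : ℝ × ℝ → ℝ} (hc : PolyGrowth c) (hf : RapidDecay f) :
    RapidDecay fun x => (c x : ℂ) * f x := by
  refine ⟨(Complex.continuous_ofReal.comp hc.continuous).mul hf.continuous, fun k => ?_⟩
  obtain ⟨D, l, hD⟩ := hc.growth
  have hD0 : 0 ≤ D := by simpa using (abs_nonneg _).trans (hD 0)
  obtain ⟨C, hC⟩ := hf.decay (k + l)
  refine ⟨D * C, fun x => ?_⟩
  rw [norm_mul, Complex.norm_real, Real.norm_eq_abs]
  calc (1 + ‖x‖) ^ k * (|c x| * ‖f x‖)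
      ≤ (1 + ‖x‖) ^ k * (D * (1 + ‖x‖) ^ l * ‖f x‖) := by gcongr; exact hD x
    _ = D * ((1 + ‖x‖) ^ (k + l) * ‖f x‖) := by ring
    _ ≤ D * C := mul_le_mul_of_nonneg_left (hC x) hD0

theorem mul (hf : RapidDecay f) (hg : RapidDecay g) : RapidDecay fun x => f x * g x := by
  refine ⟨hf.continuous.mul hg.continuous, fun k => ?_⟩
  obtain ⟨C, hC⟩ := hf.decay k
  obtain ⟨D, hD⟩ := hg.decay 0
  refine ⟨C * D, fun x => ?_⟩
  have hD' : ‖g x‖ ≤ D := by simpa using hD x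
  rw [norm_mul, ← mul_assoc]
  exact mul_le_mul (hC x) hD' (norm_nonneg _) ((by positivity : (0 : ℝ) ≤ _).trans (hC x))

theorem integrable (hf : RapidDecay f) : Integrable f := by
  obtain ⟨C, hC⟩ := hf.decay 3
  have hint : Integrable fun x : ℝ × ℝ => C * (1 + ‖x‖) ^ (-(3 : ℝ)) :=
    (integrable_one_add_norm (by simp; norm_num)).const_mul C
  refine hint.mono' hf.continuous.aestronglyMeasurable (ae_of_all _ fun x => ?_)
  have h0 : (0 : ℝ) < (1 + ‖x‖) ^ 3 := by positivity
  rw [Real.rpow_neg (by positivity), ← div_eq_mul_inv]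
  have : (1 + ‖x‖) ^ (3 : ℝ) = (1 + ‖x‖) ^ 3 := by exact_mod_cast Real.rpow_natCast _ 3
  rw [this, le_div_iff₀ h0, mul_comm]
  exact hC x

theorem memLp (hf : RapidDecay f) : MemLp f 2 volume := by
  rw [memLp_two_iff_integrable_sq_norm hf.continuous.aestronglyMeasurable]
  refine (hf.mul hf).integrable.norm.congr (ae_of_all _ fun x => ?_)
  simp [sq]

end RapidDecay

/-! ### Covariant derivatives and integration by parts -/

/-- The covariant derivative `-i ∂_v - c` acting on Schwartz functions; `P₁` is the case
`v = (1, 0)`, `c = 0`, and `P₂ - a(x₁)` the case `v = (0, 1)`, `c = a(x₁)`. -/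
noncomputable def covDeriv (v : ℝ × ℝ) (c : ℝ × ℝ → ℝ) (φ : 𝓢(ℝ × ℝ, ℂ)) (x : ℝ × ℝ) : ℂ :=
  -Complex.I * LineDeriv.lineDerivOp v φ x - (c x : ℂ) * φ x

theorem hasLineDerivAt_schwartz (φ : 𝓢(ℝ × ℝ, ℂ)) (x v : ℝ × ℝ) :
    HasLineDerivAt ℝ φ (LineDeriv.lineDerivOp v φ x) x v := by
  rw [SchwartzMap.lineDerivOp_apply]
  exact φ.differentiableAt.lineDifferentiableAt.hasLineDerivAt

section CovDeriv

variable {v : ℝ × ℝ} {c : ℝ × ℝ → ℝ}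

theorem RapidDecay.covDeriv (hc : PolyGrowth c) (φ : 𝓢(ℝ × ℝ, ℂ)) :
    RapidDecay (covDeriv v c φ) := by
  have h := ((RapidDecay.schwartz (LineDeriv.lineDerivOp v φ)).const_mul (-Complex.I)).add
    (((RapidDecay.schwartz φ).polyGrowth_mul hc).const_mul (-1))
  refine cast (congrArg RapidDecay ?_) h
  funext x
  simp only [MagneticField.covDeriv]
  ring

theorem hasLineDerivAt_covDeriv (hcv : ∀ (x : ℝ × ℝ) (t : ℝ), c (x + t • v) = c x)
    (φ : 𝓢(ℝ × ℝ, ℂ)) (x : ℝ × ℝ) :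
    HasLineDerivAt ℝ (covDeriv v c φ) (covDeriv v c (LineDeriv.lineDerivOp v φ) x) x v := by
  have h := (HasDerivAt.const_mul (-Complex.I)
    (hasLineDerivAt_schwartz (LineDeriv.lineDerivOp v φ) x v)).sub
    (HasDerivAt.const_mul (c x : ℂ) (hasLineDerivAt_schwartz φ x v))
  refine HasDerivAt.congr_deriv (h.congr_of_eventuallyEq (Eventually.of_forall fun t => ?_)) rfl
  simp [covDeriv, hcv]

/-- Symmetry of the covariant derivative: `⟨φ, D D φ⟩ = ‖D φ‖²`. -/
theorem integral_conj_mul_covDeriv_covDeriv (hc : PolyGrowth c)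
    (hcv : ∀ (x : ℝ × ℝ) (t : ℝ), c (x + t • v) = c x) (φ : 𝓢(ℝ × ℝ, ℂ)) :
    ∫ x, (starRingEnd ℂ) (φ x) * (-Complex.I * covDeriv v c (LineDeriv.lineDerivOp v φ) x
        - (c x : ℂ) * covDeriv v c φ x) =
      ∫ x, (starRingEnd ℂ) (covDeriv v c φ x) * covDeriv v c φ x := by
  have r0 := (RapidDecay.schwartz φ).conj
  have r1 := (RapidDecay.schwartz (LineDeriv.lineDerivOp v φ)).conj
  have s0 : RapidDecay (covDeriv v c φ) := RapidDecay.covDeriv hc φ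
  have s1 : RapidDecay (covDeriv v c (LineDeriv.lineDerivOp v φ)) := RapidDecay.covDeriv hc _
  have hparts := integral_bilinear_hasLineDerivAt_right_eq_neg_left_of_integrable
    (μ := (volume : Measure (ℝ × ℝ))) (v := v) (B := ContinuousLinearMap.mul ℝ ℂ)
    (f := fun x => (starRingEnd ℂ) (φ x))
    (f' := fun x => (starRingEnd ℂ) (LineDeriv.lineDerivOp v φ x))
    (g := covDeriv v c φ) (g' := covDeriv v c (LineDeriv.lineDerivOp v φ))
    (r1.mul s0).integrable (r0.mul s1).integrable (r0.mul s0).integrable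
    (fun x _ => HasDerivAt.star (hasLineDerivAt_schwartz φ x v))
    (fun x _ => hasLineDerivAt_covDeriv hcv φ x)
  simp only [ContinuousLinearMap.mul_apply'] at hparts
  have i0 := (r0.mul (s0.polyGrowth_mul hc)).integrable
  have e1 : ∀ x, (starRingEnd ℂ) (φ x) * (-Complex.I * covDeriv v c (LineDeriv.lineDerivOp v φ) x
      - (c x : ℂ) * covDeriv v c φ x) =
      -Complex.I * ((starRingEnd ℂ) (φ x) * covDeriv v c (LineDeriv.lineDerivOp v φ) x)
        - (starRingEnd ℂ) (φ x) * ((c x : ℂ) * covDeriv v c φ x) := fun x => by ring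
  have e2 : ∀ x, (starRingEnd ℂ) (covDeriv v c φ x) * covDeriv v c φ x =
      Complex.I * ((starRingEnd ℂ) (LineDeriv.lineDerivOp v φ x) * covDeriv v c φ x)
        - (starRingEnd ℂ) (φ x) * ((c x : ℂ) * covDeriv v c φ x) := fun x => by
    conv_lhs => enter [1]; rw [covDeriv]
    simp only [map_sub, map_mul, map_neg, Complex.conj_I, Complex.conj_ofReal]
    ring
  simp only [e1, e2]
  rw [integral_sub ((r0.mul s1).integrable.const_mul _) i0,
    integral_sub ((r1.mul s0).integrable.const_mul _) i0, integral_const_mul, integral_const_mul,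
    hparts]
  ring

end CovDeriv

section Energy

variable {b : ℝ → ℝ}

theorem P₁_eq_covDeriv (φ : 𝓢(ℝ × ℝ, ℂ)) : P₁ φ = covDeriv (1, 0) (fun _ => 0) φ := by
  funext x
  simp [P₁, covDeriv, (hasLineDerivAt_schwartz φ x (1, 0)).lineDeriv]

theorem velocity₂_eq_covDeriv (φ : 𝓢(ℝ × ℝ, ℂ)) :
    velocity₂ b φ = covDeriv (0, 1) (fun x => antideriv b x.1) φ := by
  funext x
  simp [velocity₂, P₂, covDeriv, (hasLineDerivAt_schwartz φ x (0, 1)).lineDeriv]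

theorem hamiltonianExpr_eq_covDeriv (φ : 𝓢(ℝ × ℝ, ℂ)) (x : ℝ × ℝ) :
    hamiltonianExpr b φ x = (1 / 2) *
      ((-Complex.I * covDeriv (1, 0) (fun _ => 0) (LineDeriv.lineDerivOp ((1, 0) : ℝ × ℝ) φ) x
          - ((0 : ℝ) : ℂ) * covDeriv (1, 0) (fun _ => 0) φ x)
        + (-Complex.I * covDeriv (0, 1) (fun x => antideriv b x.1)
              (LineDeriv.lineDerivOp ((0, 1) : ℝ × ℝ) φ) x
          - (antideriv b x.1 : ℂ) * covDeriv (0, 1) (fun x => antideriv b x.1) φ x)) := by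
  rw [hamiltonianExpr, P₁_eq_covDeriv, velocity₂_eq_covDeriv, P₁, velocity₂, P₂,
    (hasLineDerivAt_covDeriv (fun _ _ => rfl) φ x).lineDeriv,
    (hasLineDerivAt_covDeriv (fun _ _ => by simp) φ x).lineDeriv]
  simp

theorem re_integral_conj_mul_self {f : ℝ × ℝ → ℂ} (hf : RapidDecay f) :
    (∫ x, (starRingEnd ℂ) (f x) * f x).re = ‖hf.memLp.toLp f‖ ^ 2 := by
  rw [← inner_self_eq_norm_sq (𝕜 := ℂ), L2.inner_def]
  congr 1
  refine integral_congr_ae ?_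
  filter_upwards [hf.memLp.coeFn_toLp] with x hx
  rw [hx, RCLike.inner_apply, mul_comm]

/-- The kinetic energy of the motion along `x₂` is at most the total energy: on Schwartz
functions `‖(P₂ - a(Q₁)) ψ‖² ≤ 2 ⟨ψ, H(b) ψ⟩`. -/
theorem norm_velocity₂_sq_le (hb : IsUMF b) {φ : 𝓢(ℝ × ℝ, ℂ)} {ψ y : L2Plane}
    (hψ : ψ =ᵐ[volume] φ) (hy : y =ᵐ[volume] hamiltonianExpr b φ) :
    ‖(RapidDecay.covDeriv (v := (0, 1)) hb.polyGrowth φ).memLp.toLp _‖ ^ 2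
      ≤ 2 * (⟪ψ, y⟫_ℂ).re := by
  have h1 := integral_conj_mul_covDeriv_covDeriv (v := (1, 0)) PolyGrowth.zero
    (fun _ _ => rfl) φ
  have h2 := integral_conj_mul_covDeriv_covDeriv (v := (0, 1)) hb.polyGrowth
    (fun _ _ => by simp) φ
  have r0 := (RapidDecay.schwartz φ).conj
  have s : ∀ (v : ℝ × ℝ) {c : ℝ × ℝ → ℝ}, PolyGrowth c → RapidDecay fun x =>
      (starRingEnd ℂ) (φ x) * (-Complex.I * covDeriv v c (LineDeriv.lineDerivOp v φ) x
        - (c x : ℂ) * covDeriv v c φ x) := by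
    intro v c hc
    have h := r0.mul (((RapidDecay.covDeriv (v := v) hc
      (LineDeriv.lineDerivOp v φ)).const_mul (-Complex.I)).add
      (((RapidDecay.covDeriv (v := v) hc φ).polyGrowth_mul hc).const_mul (-1)))
    refine cast (congrArg RapidDecay ?_) h
    funext x
    ring
  have hin : ⟪ψ, y⟫_ℂ = (1 / 2) *
      ((∫ x, (starRingEnd ℂ) (covDeriv (1, 0) (fun _ => 0) φ x)
          * covDeriv (1, 0) (fun _ => 0) φ x)
        + ∫ x, (starRingEnd ℂ) (covDeriv (0, 1) (fun x => antideriv b x.1) φ x)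
          * covDeriv (0, 1) (fun x => antideriv b x.1) φ x) := by
    rw [← h1, ← h2, ← integral_add (s _ PolyGrowth.zero).integrable
      (s _ hb.polyGrowth).integrable, ← integral_const_mul, L2.inner_def]
    refine integral_congr_ae ?_
    filter_upwards [hψ, hy] with x hx hx'
    rw [hx, hx', hamiltonianExpr_eq_covDeriv, RCLike.inner_apply]
    ring
  have hre : (2 * (⟪ψ, y⟫_ℂ).re) =
      (∫ x, (starRingEnd ℂ) (covDeriv (1, 0) (fun _ => 0) φ x)
          * covDeriv (1, 0) (fun _ => 0) φ x).re
        + (∫ x, (starRingEnd ℂ) (covDeriv (0, 1) (fun x => antideriv b x.1) φ x)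
          * covDeriv (0, 1) (fun x => antideriv b x.1) φ x).re := by
    rw [← Complex.add_re, ← Complex.re_ofReal_mul, hin]
    congr 1
    push_cast
    ring
  rw [hre, re_integral_conj_mul_self (RapidDecay.covDeriv PolyGrowth.zero φ),
    re_integral_conj_mul_self (RapidDecay.covDeriv hb.polyGrowth φ)]
  nlinarith [sq_nonneg ‖(RapidDecay.covDeriv (v := (1, 0)) PolyGrowth.zero φ).memLp.toLp _‖]

end Energy

/-! ### Translations and phases -/

/-- The translation `(τ_s ψ)(x₁, x₂) = ψ(x₁, x₂ + s)`, that is `e^{i s P₂}`. -/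
noncomputable def shift (s : ℝ) : L2Plane →ₗᵢ[ℂ] L2Plane :=
  Lp.compMeasurePreservingₗᵢ ℂ (fun x : ℝ × ℝ => x + (0, s))
    (measurePreserving_add_right volume ((0, s) : ℝ × ℝ))

theorem coeFn_shift (s : ℝ) (ψ : L2Plane) : shift s ψ =ᵐ[volume] fun x => ψ (x + (0, s)) :=
  Lp.coeFn_compMeasurePreserving ψ (measurePreserving_add_right volume ((0, s) : ℝ × ℝ))

theorem memLp_phase_mul {f : ℝ × ℝ → ℝ} (hf : Continuous f) (ψ : L2Plane) :
    MemLp (fun x => Complex.exp (Complex.I * f x) * ψ x) 2 volume := by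
  refine (Lp.memLp ψ).of_le ?_ (ae_of_all _ fun x => ?_)
  · exact (Continuous.aestronglyMeasurable (by fun_prop)).mul (Lp.aestronglyMeasurable ψ)
  · rw [norm_mul, mul_comm Complex.I, Complex.norm_exp_ofReal_mul_I, one_mul]

/-- Multiplication by `e^{i f}` with a continuous real function `f`. -/
noncomputable def phase (f : ℝ × ℝ → ℝ) (hf : Continuous f) : L2Plane →ₗᵢ[ℂ] L2Plane where
  toFun ψ := (memLp_phase_mul hf ψ).toLp _
  map_add' ψ φ := by
    rw [← MemLp.toLp_add]
    refine MemLp.toLp_congr _ _ ?_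
    filter_upwards [Lp.coeFn_add ψ φ] with x hx
    simp only [hx, Pi.add_apply, mul_add]
  map_smul' z ψ := by
    rw [RingHom.id_apply, ← MemLp.toLp_const_smul]
    refine MemLp.toLp_congr _ _ ?_
    filter_upwards [Lp.coeFn_smul z ψ] with x hx
    simp only [hx, Pi.smul_apply, smul_eq_mul, mul_left_comm]
  norm_map' ψ := by
    change ‖(memLp_phase_mul hf ψ).toLp _‖ = _
    rw [Lp.norm_toLp, Lp.norm_def]
    congr 1
    refine eLpNorm_congr_norm_ae (ae_of_all _ fun x => ?_)
    rw [norm_mul, mul_comm Complex.I, Complex.norm_exp_ofReal_mul_I, one_mul]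

theorem coeFn_phase {f : ℝ × ℝ → ℝ} (hf : Continuous f) (ψ : L2Plane) :
    phase f hf ψ =ᵐ[volume] fun x => Complex.exp (Complex.I * f x) * ψ x :=
  (memLp_phase_mul hf ψ).coeFn_toLp

/-- If `f ψ ∈ L²` then `s ↦ e^{i s f} ψ` is Lipschitz with constant `‖f ψ‖`. -/
theorem norm_phase_sub_le {f : ℝ × ℝ → ℝ} (ψ : (mulOp f).domain) {s : ℝ}
    (hs : Continuous fun x => s * f x) :
    ‖phase (fun x => s * f x) hs ψ - ψ‖ ≤ |s| * ‖mulOp f ψ‖ := by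
  rw [← Real.norm_eq_abs]
  refine Lp.norm_le_mul_norm_of_ae_le_mul ?_
  have hcoe : mulOp f ψ =ᵐ[volume] fun x => (f x : ℂ) * (ψ : L2Plane) x := MemLp.coeFn_toLp ψ.2
  filter_upwards [coeFn_phase hs (ψ : L2Plane), Lp.coeFn_sub (phase _ hs (ψ : L2Plane)) ψ, hcoe]
    with x h1 h2 h3
  rw [h2, Pi.sub_apply, h1, h3]
  have h4 := Real.norm_exp_I_mul_ofReal_sub_one_le (x := s * f x)
  calc ‖Complex.exp (Complex.I * ((s * f x : ℝ) : ℂ)) * (ψ : L2Plane) x - (ψ : L2Plane) x‖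
      = ‖Complex.exp (Complex.I * ((s * f x : ℝ) : ℂ)) - 1‖ * ‖(ψ : L2Plane) x‖ := by
        rw [← norm_mul, sub_mul, one_mul]
    _ ≤ ‖s * f x‖ * ‖(ψ : L2Plane) x‖ := by gcongr
    _ = ‖s‖ * ‖(f x : ℂ) * (ψ : L2Plane) x‖ := by
        rw [norm_mul, norm_mul, Complex.norm_real, mul_assoc]

/-- Conversely, if `s ↦ e^{i s f} ψ` is Lipschitz with constant `K` at `s = 0`, then `f ψ ∈ L²`
with norm at most `K`, by Fatou's lemma applied to the difference quotients. -/
theorem eLpNorm_mul_le_of_phase {f : ℝ × ℝ → ℝ} (hf : Continuous f) (ψ : L2Plane) {K : ℝ}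
    (hK : ∀ s : ℝ, 0 < s → ∀ hs : Continuous fun x => s * f x,
      ‖phase (fun x => s * f x) hs ψ - ψ‖ ≤ s * K) :
    eLpNorm (fun x => (f x : ℂ) * ψ x) 2 volume ≤ ENNReal.ofReal K := by
  let s : ℕ → ℝ := fun n => 1 / ((n : ℝ) + 1)
  have hs : ∀ n, 0 < s n := fun n => Nat.one_div_pos_of_nat
  have hc : ∀ n, Continuous fun x => s n * f x := fun n => by fun_prop
  let G : ℕ → ℝ × ℝ → ℂ := fun n x =>
    Complex.exp (Complex.I * ((s n * f x : ℝ) : ℂ)) * ψ x - ψ x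
  let F : ℕ → ℝ × ℝ → ℂ := fun n => (-Complex.I * (s n : ℂ)⁻¹) • G n
  refine Lp.eLpNorm_le_of_ae_tendsto (u := atTop) (f := F) (Eventually.of_forall fun n => ?_)
    (fun n => ?_) (ae_of_all _ fun x => ?_)
  · have h1 : G n =ᵐ[volume] (phase _ (hc n) ψ - ψ : L2Plane) := by
      filter_upwards [coeFn_phase (hc n) ψ, Lp.coeFn_sub (phase _ (hc n) ψ) ψ] with x h1 h2
      rw [h2, Pi.sub_apply, h1]
    have h2 : eLpNorm (F n) 2 volume = ‖(-Complex.I * (s n : ℂ)⁻¹)‖ₑ * eLpNorm (G n) 2 volume :=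
      eLpNorm_const_smul _ (G n) 2 volume
    have h3 : ‖(-Complex.I * (s n : ℂ)⁻¹)‖ = (s n)⁻¹ := by
      rw [norm_mul, norm_neg, Complex.norm_I, one_mul, norm_inv, Complex.norm_real,
        Real.norm_of_nonneg (hs n).le]
    rw [h2, eLpNorm_congr_ae h1, ← Lp.enorm_def, ← ofReal_norm, ← ofReal_norm, h3,
      ← ENNReal.ofReal_mul (inv_nonneg.2 (hs n).le)]
    refine ENNReal.ofReal_le_ofReal ?_
    rw [inv_mul_le_iff₀ (hs n)]
    exact hK _ (hs n) (hc n)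
  · have h1 : Continuous fun x => Complex.exp (Complex.I * ((s n * f x : ℝ) : ℂ)) := by fun_prop
    exact ((h1.aestronglyMeasurable.mul (Lp.aestronglyMeasurable ψ)).sub
      (Lp.aestronglyMeasurable ψ)).const_smul _
  · have h1 : HasDerivAt (fun r : ℝ => Complex.exp (Complex.I * ((r * f x : ℝ) : ℂ)))
        (Complex.I * f x) 0 := by
      have h2 : HasDerivAt (fun r : ℝ => Complex.I * ((r * f x : ℝ) : ℂ)) (Complex.I * f x) 0 := by
        simpa using (((hasDerivAt_id (0 : ℝ)).mul_const (f x)).ofReal_comp).const_mul Complex.I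
      simpa using h2.cexp
    rw [hasDerivAt_iff_tendsto_slope_zero] at h1
    have h2 : Tendsto s atTop (𝓝[≠] 0) := tendsto_nhdsWithin_iff.2
      ⟨tendsto_one_div_add_atTop_nhds_zero_nat, Eventually.of_forall fun n => (hs n).ne'⟩
    have h3 := (((h1.comp h2).const_mul (-Complex.I)).mul_const (ψ x))
    have h4 : -Complex.I * (Complex.I * f x) * ψ x = f x * ψ x := by
      linear_combination -(f x * ψ x) * Complex.I_mul_I
    rw [h4] at h3
    refine h3.congr fun n => ?_
    simp only [Function.comp_apply, zero_add, zero_mul, Complex.ofReal_zero, mul_zero,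
      Complex.exp_zero, Complex.real_smul, F, G, Pi.smul_apply, smul_eq_mul]
    push_cast
    ring

/-! ### Magnetic translations -/

section MagneticShift

variable {b : ℝ → ℝ}

theorem IsUMF.continuous_phase (hb : IsUMF b) (s : ℝ) :
    Continuous fun x : ℝ × ℝ => s * antideriv b x.1 :=
  continuous_const.mul (hb.continuous_antideriv.comp continuous_fst)

/-- The magnetic translation `e^{i s (P₂ - a(Q₁))}`, that is
`ψ ↦ e^{-i s a(x₁)} ψ(x₁, x₂ + s)`. -/
noncomputable def magShift (hb : IsUMF b) (s : ℝ) : L2Plane →ₗᵢ[ℂ] L2Plane :=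
  (phase _ (hb.continuous_phase (-s))).comp (shift s)

theorem phase_magShift (hb : IsUMF b) (s : ℝ) (ψ : L2Plane) :
    phase _ (hb.continuous_phase s) (magShift hb s ψ) = shift s ψ := by
  refine Lp.ext ?_
  filter_upwards [coeFn_phase (hb.continuous_phase s) (magShift hb s ψ),
    coeFn_phase (hb.continuous_phase (-s)) (shift s ψ)] with x h1 h2
  change magShift hb s ψ x = _ at h2
  rw [h1, h2, ← mul_assoc, ← Complex.exp_add]
  simp

/-- The Cauchy–Schwarz inequality for a function against the constant `1`. -/
theorem sq_lintegral_le {α : Type*} [MeasurableSpace α] {μ : Measure α} {g : α → ℝ≥0∞}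
    (hg : AEMeasurable g μ) : (∫⁻ x, g x ∂μ) ^ 2 ≤ μ Set.univ * ∫⁻ x, g x ^ 2 ∂μ := by
  have h := ENNReal.lintegral_mul_le_Lp_mul_Lq μ Real.HolderConjugate.two_two
    (aemeasurable_const (b := (1 : ℝ≥0∞))) hg
  simp only [Pi.mul_apply, one_mul, ENNReal.rpow_two, one_pow, lintegral_one] at h
  calc (∫⁻ x, g x ∂μ) ^ 2
      ≤ (μ Set.univ ^ (1 / 2 : ℝ) * (∫⁻ x, g x ^ 2 ∂μ) ^ (1 / 2 : ℝ)) ^ 2 := by gcongr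
    _ = μ Set.univ * ∫⁻ x, g x ^ 2 ∂μ := by
        rw [mul_pow, ← ENNReal.rpow_two, ← ENNReal.rpow_two, ← ENNReal.rpow_mul,
          ← ENNReal.rpow_mul]
        norm_num

theorem eLpNorm_two_sq (f : ℝ × ℝ → ℂ) :
    eLpNorm f 2 volume ^ 2 = ∫⁻ x, ‖f x‖ₑ ^ 2 := by
  have h := eLpNorm_nnreal_pow_eq_lintegral (μ := (volume : Measure (ℝ × ℝ))) (f := f)
    (p := 2) two_ne_zero
  simpa using h

/-- The fundamental theorem of calculus along an orbit of the magnetic translations. -/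
theorem magShift_sub_eq_integral (φ : 𝓢(ℝ × ℝ, ℂ)) (x : ℝ × ℝ) (s : ℝ)
    (hc : Continuous (covDeriv (0, 1) (fun x => antideriv b x.1) φ)) :
    Complex.exp (Complex.I * ((-s * antideriv b x.1 : ℝ) : ℂ)) * φ (x + (0, s)) - φ x =
      ∫ r in (0 : ℝ)..s, Complex.I * Complex.exp (Complex.I * ((-r * antideriv b x.1 : ℝ) : ℂ)) *
        covDeriv (0, 1) (fun x => antideriv b x.1) φ (x + (0, r)) := by
  have hd : ∀ r : ℝ, HasDerivAt
      (fun r : ℝ => Complex.exp (Complex.I * ((-r * antideriv b x.1 : ℝ) : ℂ)) * φ (x + (0, r)))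
      (Complex.I * Complex.exp (Complex.I * ((-r * antideriv b x.1 : ℝ) : ℂ)) *
        covDeriv (0, 1) (fun x => antideriv b x.1) φ (x + (0, r))) r := by
    intro r
    have h1 : HasDerivAt (fun r : ℝ => Complex.I * ((-r * antideriv b x.1 : ℝ) : ℂ))
        (-(Complex.I * antideriv b x.1)) r := by
      simpa using
        ((((hasDerivAt_id r).neg.mul_const (antideriv b x.1)).ofReal_comp).const_mul Complex.I)
    have h2 : HasDerivAt (fun r : ℝ => φ (x + (0, r)))
        (LineDeriv.lineDerivOp ((0, 1) : ℝ × ℝ) φ (x + (0, r))) r := by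
      have h := hasLineDerivAt_schwartz φ (x + (0, r)) (0, 1)
      have h3 : HasDerivAt (fun t : ℝ => t - r) 1 r := (hasDerivAt_id r).sub_const r
      have h4 : HasDerivAt (fun t : ℝ => φ (x + (0, r) + t • ((0, 1) : ℝ × ℝ)))
          (LineDeriv.lineDerivOp ((0, 1) : ℝ × ℝ) φ (x + (0, r))) (r - r) := by
        rw [sub_self]; exact h
      have h5 := HasDerivAt.scomp (h := fun t => t - r) r h4 h3
      rw [one_smul] at h5
      refine h5.congr_of_eventuallyEq (Eventually.of_forall fun t => ?_)
      simp [add_assoc]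
    refine (h1.cexp.mul h2).congr_deriv ?_
    simp only [covDeriv, Prod.fst_add, add_zero]
    linear_combination (Complex.exp (Complex.I * ((-r * antideriv b x.1 : ℝ) : ℂ)) *
      LineDeriv.lineDerivOp ((0, 1) : ℝ × ℝ) φ (x + (0, r))) * Complex.I_mul_I
  rw [intervalIntegral.integral_eq_sub_of_hasDerivAt (fun r _ => hd r)
    (Continuous.intervalIntegrable (by fun_prop) _ _)]
  have h0 : x + ((0, 0) : ℝ × ℝ) = x := by ext <;> simp
  simp [h0]

theorem eLpNorm_magShift_sub_le (hb : IsUMF b) (φ : 𝓢(ℝ × ℝ, ℂ)) {s : ℝ} (hs : 0 ≤ s) :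
    eLpNorm (fun x => Complex.exp (Complex.I * ((-s * antideriv b x.1 : ℝ) : ℂ))
        * φ (x + (0, s)) - φ x) 2 volume ≤
      ENNReal.ofReal s *
        eLpNorm (covDeriv (0, 1) (fun x => antideriv b x.1) φ) 2 volume := by
  set D := covDeriv (0, 1) (fun x => antideriv b x.1) φ with hD
  have hDc : Continuous D := (RapidDecay.covDeriv hb.polyGrowth φ).continuous
  have hpt : ∀ x : ℝ × ℝ, ‖Complex.exp (Complex.I * ((-s * antideriv b x.1 : ℝ) : ℂ))
      * φ (x + (0, s)) - φ x‖ₑ ^ 2 ≤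
      ENNReal.ofReal s * ∫⁻ r in Set.Ioc 0 s, ‖D (x + (0, r))‖ₑ ^ 2 := by
    intro x
    rw [magShift_sub_eq_integral φ x s hDc, intervalIntegral.integral_of_le hs]
    have h1 : ∀ r : ℝ, ‖Complex.I * Complex.exp (Complex.I * ((-r * antideriv b x.1 : ℝ) : ℂ)) *
        D (x + (0, r))‖ₑ = ‖D (x + (0, r))‖ₑ := by
      intro r
      rw [enorm_eq_iff_norm_eq, norm_mul, norm_mul, mul_comm Complex.I ((_ : ℝ) : ℂ),
        Complex.norm_exp_ofReal_mul_I, Complex.norm_I, one_mul, one_mul]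
    have h2 := enorm_integral_le_lintegral_enorm (μ := volume.restrict (Set.Ioc 0 s)) fun r : ℝ =>
      Complex.I * Complex.exp (Complex.I * ((-r * antideriv b x.1 : ℝ) : ℂ)) * D (x + (0, r))
    simp only [h1] at h2
    have h3 : Continuous fun r : ℝ => ‖D (x + (0, r))‖ₑ :=
      continuous_enorm.comp (hDc.comp (by fun_prop))
    refine (pow_le_pow_left₀ (zero_le) h2 2).trans ((sq_lintegral_le h3.aemeasurable).trans_eq ?_)
    simp
  have hsq : eLpNorm (fun x => Complex.exp (Complex.I * ((-s * antideriv b x.1 : ℝ) : ℂ))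
      * φ (x + (0, s)) - φ x) 2 volume ^ 2 ≤ (ENNReal.ofReal s * eLpNorm D 2 volume) ^ 2 := by
    rw [mul_pow, eLpNorm_two_sq, eLpNorm_two_sq]
    calc _ ≤ ∫⁻ x : ℝ × ℝ, ENNReal.ofReal s * ∫⁻ r in Set.Ioc 0 s, ‖D (x + (0, r))‖ₑ ^ 2 :=
          lintegral_mono hpt
      _ = ENNReal.ofReal s * ∫⁻ r in Set.Ioc 0 s, ∫⁻ x : ℝ × ℝ, ‖D (x + (0, r))‖ₑ ^ 2 := by
          have hcont : Continuous fun p : (ℝ × ℝ) × ℝ => ‖D (p.1 + (0, p.2))‖ₑ ^ 2 :=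
            (ENNReal.continuous_pow 2).comp (continuous_enorm.comp (hDc.comp (by fun_prop)))
          rw [lintegral_const_mul' _ _ ENNReal.ofReal_ne_top,
            lintegral_lintegral_swap hcont.aemeasurable]
      _ = ENNReal.ofReal s * ∫⁻ _ in Set.Ioc 0 s, ∫⁻ x : ℝ × ℝ, ‖D x‖ₑ ^ 2 := by
          congr 2
          funext r
          exact lintegral_add_right_eq_self (fun x => ‖D x‖ₑ ^ 2) ((0, r) : ℝ × ℝ)
      _ = _ := by
          rw [setLIntegral_const, Real.volume_Ioc, sub_zero]
          ring
  exact (ENNReal.pow_le_pow_left_iff two_ne_zero).1 hsq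

/-- `‖e^{i s (P₂ - a(Q₁))} φ - φ‖ ≤ s ‖(P₂ - a(Q₁)) φ‖` for Schwartz functions `φ`. -/
theorem norm_magShift_sub_le (hb : IsUMF b) {φ : 𝓢(ℝ × ℝ, ℂ)} {ψ : L2Plane}
    (hψ : ψ =ᵐ[volume] φ) {s : ℝ} (hs : 0 ≤ s) :
    ‖magShift hb s ψ - ψ‖ ≤
      s * ‖(RapidDecay.covDeriv (v := (0, 1)) hb.polyGrowth φ).memLp.toLp _‖ := by
  have hmem := (RapidDecay.covDeriv (v := (0, 1)) hb.polyGrowth φ).memLp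
  have hshift : (fun x => ψ (x + (0, s))) =ᵐ[volume] fun x => φ (x + (0, s)) :=
    (measurePreserving_add_right volume ((0, s) : ℝ × ℝ)).quasiMeasurePreserving.ae_eq_comp hψ
  have hae : (magShift hb s ψ - ψ : L2Plane) =ᵐ[volume] fun x =>
      Complex.exp (Complex.I * ((-s * antideriv b x.1 : ℝ) : ℂ)) * φ (x + (0, s)) - φ x := by
    filter_upwards [Lp.coeFn_sub (magShift hb s ψ) ψ, hψ, hshift, coeFn_shift s ψ,
      coeFn_phase (hb.continuous_phase (-s)) (shift s ψ)] with x h1 h2 h3 h4 h5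
    change magShift hb s ψ x = _ at h5
    rw [h1, Pi.sub_apply, h2, h5, h4, h3]
  have h := eLpNorm_magShift_sub_le hb φ hs
  rw [← eLpNorm_congr_ae hae] at h
  have h2 := ENNReal.toReal_mono (ENNReal.mul_ne_top ENNReal.ofReal_ne_top hmem.eLpNorm_ne_top) h
  rwa [ENNReal.toReal_mul, ENNReal.toReal_ofReal hs, ← Lp.norm_def, ← Lp.norm_toLp _ hmem] at h2

end MagneticShift

/-! ### The Hamiltonian -/

section Hamiltonian

variable {b : ℝ → ℝ}

theorem hamiltonianSchwartz_graph (b : ℝ → ℝ) : (hamiltonianSchwartz b).graph = schwartzGraph b :=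
  Submodule.toLinearPMap_graph_eq _ (schwartzGraph_functional b)

/-- Schwartz functions are a core of `H(b)`. -/
theorem hamiltonian_graph_le (b : ℝ → ℝ) :
    (hamiltonian b).graph ≤ (schwartzGraph b).topologicalClosure := by
  rw [← hamiltonianSchwartz_graph]
  by_cases h : (hamiltonianSchwartz b).IsClosable
  · exact h.graph_closure_eq_closure_graph.ge
  · rw [hamiltonian, LinearPMap.closure_def' h]
    exact Submodule.le_topologicalClosure _

theorem shift_schwartzGraph (s : ℝ) {p : L2Plane × L2Plane} (hp : p ∈ schwartzGraph b) :
    (shift s p.1, shift s p.2) ∈ schwartzGraph b := by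
  obtain ⟨φ, h1, h2⟩ := hp
  have hq := (measurePreserving_add_right (volume : Measure (ℝ × ℝ))
    ((0, s) : ℝ × ℝ)).quasiMeasurePreserving
  have hφ : ∀ (χ : 𝓢(ℝ × ℝ, ℂ)) (x : ℝ × ℝ),
      χ.compSubConstCLM ℂ (-((0, s) : ℝ × ℝ)) x = χ (x + (0, s)) := fun χ x => by
    rw [SchwartzMap.compSubConstCLM_apply, sub_neg_eq_add]
  have hline : ∀ (χ : 𝓢(ℝ × ℝ, ℂ)) (v : ℝ × ℝ),
      LineDeriv.lineDerivOp v (χ.compSubConstCLM ℂ (-((0, s) : ℝ × ℝ))) =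
        (LineDeriv.lineDerivOp v χ).compSubConstCLM ℂ (-((0, s) : ℝ × ℝ)) := by
    intro χ v
    ext x
    rw [hφ, ← (hasLineDerivAt_schwartz _ x v).lineDeriv,
      ← (hasLineDerivAt_schwartz χ (x + (0, s)) v).lineDeriv]
    simp only [lineDeriv, hφ, add_right_comm]
  refine ⟨φ.compSubConstCLM ℂ (-((0, s) : ℝ × ℝ)), ?_, ?_⟩
  · filter_upwards [coeFn_shift s p.1, hq.ae_eq_comp h1] with x h3 h4
    rw [h3, hφ]
    exact h4
  · filter_upwards [coeFn_shift s p.2, hq.ae_eq_comp h2] with x h3 h4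
    rw [h3]
    refine Eq.trans h4 ?_
    simp only [Function.comp_apply, hamiltonianExpr_schwartz, hline, hφ, Prod.fst_add, add_zero]

/-- `H(b)` is invariant under the translations along `x₂`. -/
theorem shift_hamiltonian (s : ℝ) {x y : L2Plane} (h : (x, y) ∈ (hamiltonian b).graph) :
    (shift s x, shift s y) ∈ (hamiltonian b).graph := by
  by_cases hc : (hamiltonianSchwartz b).IsClosable
  · have hg := hc.graph_closure_eq_closure_graph
    rw [hamiltonianSchwartz_graph] at hg
    change _ = (hamiltonian b).graph at hg
    rw [← hg, ← SetLike.mem_coe, Submodule.topologicalClosure_coe] at h ⊢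
    exact map_mem_closure (f := fun p : L2Plane × L2Plane => (shift s p.1, shift s p.2))
      (by fun_prop) h fun p hp => shift_schwartzGraph s hp
  · rw [hamiltonian, LinearPMap.closure_def' hc, hamiltonianSchwartz_graph] at h ⊢
    exact shift_schwartzGraph s h

theorem norm_magShift_sub_sq_le_of_mem_schwartzGraph (hb : IsUMF b) {p : L2Plane × L2Plane}
    (hp : p ∈ schwartzGraph b) {s : ℝ} (hs : 0 ≤ s) :
    ‖magShift hb s p.1 - p.1‖ ^ 2 ≤ s ^ 2 * (2 * (⟪p.1, p.2⟫_ℂ).re) := by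
  obtain ⟨φ, h1, h2⟩ := hp
  have h3 := norm_magShift_sub_le hb h1 hs
  have h4 := norm_velocity₂_sq_le hb h1 h2
  have h5 := pow_le_pow_left₀ (norm_nonneg _) h3 2
  rw [mul_pow] at h5
  exact h5.trans (mul_le_mul_of_nonneg_left h4 (sq_nonneg s))

/-- The magnetic translations are Lipschitz on vectors of finite energy. -/
theorem norm_magShift_sub_sq_le (hb : IsUMF b) {x y : L2Plane}
    (h : (x, y) ∈ (hamiltonian b).graph) {s : ℝ} (hs : 0 ≤ s) :
    ‖magShift hb s x - x‖ ^ 2 ≤ s ^ 2 * (2 * (⟪x, y⟫_ℂ).re) := by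
  have hmem : (x, y) ∈ closure (schwartzGraph b : Set (L2Plane × L2Plane)) := by
    have h1 := hamiltonian_graph_le b h
    rwa [← SetLike.mem_coe, Submodule.topologicalClosure_coe] at h1
  obtain ⟨p, hp, hlim⟩ := mem_closure_iff_seq_limit.1 hmem
  have h1 : Tendsto (fun n => (p n).1) atTop (𝓝 x) := (continuous_fst.tendsto _).comp hlim
  have h2 : Tendsto (fun n => (p n).2) atTop (𝓝 y) := (continuous_snd.tendsto _).comp hlim
  refine le_of_tendsto_of_tendsto'
    (((((magShift hb s).continuous.tendsto x).comp h1).sub h1).norm.pow 2)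
    ((((Complex.continuous_re.tendsto _).comp (h1.inner h2)).const_mul 2).const_mul (s ^ 2))
    fun n => ?_
  exact norm_magShift_sub_sq_le_of_mem_schwartzGraph hb (hp n) hs

end Hamiltonian

/-! ### Orbits of finite energy -/

section Orbit

variable {b : ℝ → ℝ} {U : ℝ → L2Plane ≃ₗᵢ[ℂ] L2Plane} {T : L2Plane →ₗ.[ℂ] L2Plane}
  {ψ₀ ζ : L2Plane}

/-- Conservation of energy: the Lipschitz bound for the magnetic translations holds uniformly
along the orbit of a vector of `Dom H(b)^{1/2}`. -/
theorem norm_magShift_orbit_sub_le (hb : IsUMF b) (hT : IsNonnegSqrt (hamiltonian b) T)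
    (hU : IsUnitaryGroupOf (hamiltonian b) U) (hψ : (ψ₀, ζ) ∈ T.graph) (t : ℝ) {s : ℝ}
    (hs : 0 ≤ s) : ‖magShift hb s (U t ψ₀) - U t ψ₀‖ ≤ s * (√2 * ‖ζ‖) := by
  obtain ⟨φ, y, h1, h2, h3⟩ := hT.exists_seq_approx hψ
  have h4 : Tendsto (fun n => U t (φ n)) atTop (𝓝 (U t ψ₀)) :=
    ((U t).continuous.tendsto ψ₀).comp h3
  refine le_of_tendsto'
    ((((magShift hb s).continuous.tendsto _).comp h4).sub h4).norm fun n => ?_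
  refine abs_le_of_sq_le_sq' ?_ (by positivity) |>.2
  refine (norm_magShift_sub_sq_le hb (hU.map_graph t (h1 n)) hs).trans ?_
  rw [LinearIsometryEquiv.inner_map_map, mul_pow, mul_pow, Real.sq_sqrt zero_le_two]
  have := h2 n
  gcongr

theorem shift_orbit (hT : IsNonnegSqrt (hamiltonian b) T)
    (hU : IsUnitaryGroupOf (hamiltonian b) U) (hψ : (ψ₀, ζ) ∈ T.graph) (s t : ℝ) :
    shift s (U t ψ₀) = U t (shift s ψ₀) := by
  obtain ⟨φ, y, h1, -, h3⟩ := hT.exists_seq_approx hψ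
  have h4 : Tendsto (fun n => shift s (U t (φ n))) atTop (𝓝 (shift s (U t ψ₀))) :=
    (((shift s).continuous.comp (U t).continuous).tendsto ψ₀).comp h3
  have h5 : Tendsto (fun n => U t (shift s (φ n))) atTop (𝓝 (U t (shift s ψ₀))) :=
    (((U t).continuous.comp (shift s).continuous).tendsto ψ₀).comp h3
  refine tendsto_nhds_unique h4 (h5.congr fun n => ?_)
  exact (hU.comm_isometry (fun _ _ h => hT.symm h h) (shift s)
    (fun _ _ => shift_hamiltonian s) (h1 n) t).symm

/-- Conservation of the momentum `P₂`: the Lipschitz bound for the translations along `x₂`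
propagates from `ψ₀` to the whole orbit. -/
theorem norm_shift_orbit_sub_le (hb : IsUMF b) (hT : IsNonnegSqrt (hamiltonian b) T)
    (hU : IsUnitaryGroupOf (hamiltonian b) U) (hψ : (ψ₀, ζ) ∈ T.graph)
    (ha : ψ₀ ∈ (aQ₁ b).domain) (t : ℝ) {s : ℝ} (hs : 0 ≤ s) :
    ‖shift s (U t ψ₀) - U t ψ₀‖ ≤ s * (√2 * ‖ζ‖ + ‖aQ₁ b ⟨ψ₀, ha⟩‖) := by
  have h1 := norm_magShift_orbit_sub_le hb hT hU hψ 0 hs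
  rw [hU.map_zero] at h1
  have h2 := norm_phase_sub_le (⟨ψ₀, ha⟩ : (aQ₁ b).domain) (hb.continuous_phase s)
  rw [abs_of_nonneg hs] at h2
  rw [shift_orbit hT hU hψ, ← map_sub, LinearIsometryEquiv.norm_map,
    ← phase_magShift hb s ψ₀]
  calc ‖phase _ (hb.continuous_phase s) (magShift hb s ψ₀) - ψ₀‖
      ≤ ‖phase _ (hb.continuous_phase s) (magShift hb s ψ₀)
          - phase _ (hb.continuous_phase s) ψ₀‖
        + ‖phase _ (hb.continuous_phase s) ψ₀ - ψ₀‖ := norm_sub_le_norm_sub_add_norm_sub _ _ _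
    _ ≤ s * (√2 * ‖ζ‖) + s * ‖aQ₁ b ⟨ψ₀, ha⟩‖ := by
        rw [← map_sub, LinearIsometry.norm_map]
        exact add_le_add h1 h2
    _ = _ := by ring

/-- `a(Q₁) = P₂ - (P₂ - a(Q₁))` is bounded along the orbit, since both terms are. -/
theorem eLpNorm_antideriv_mul_orbit_le (hb : IsUMF b) (hT : IsNonnegSqrt (hamiltonian b) T)
    (hU : IsUnitaryGroupOf (hamiltonian b) U) (hψ : (ψ₀, ζ) ∈ T.graph)
    (ha : ψ₀ ∈ (aQ₁ b).domain) (t : ℝ) :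
    eLpNorm (fun x => (antideriv b x.1 : ℂ) * U t ψ₀ x) 2 volume ≤
      ENNReal.ofReal (2 * (√2 * ‖ζ‖) + ‖aQ₁ b ⟨ψ₀, ha⟩‖) := by
  refine eLpNorm_mul_le_of_phase hb.polyGrowth.continuous (U t ψ₀) fun s hs hc => ?_
  have h1 := norm_magShift_orbit_sub_le hb hT hU hψ t hs.le
  have h2 := norm_shift_orbit_sub_le hb hT hU hψ ha t hs.le
  rw [← phase_magShift hb s (U t ψ₀)] at h2
  calc ‖phase _ hc (U t ψ₀) - U t ψ₀‖
      ≤ ‖phase _ hc (U t ψ₀) - phase _ hc (magShift hb s (U t ψ₀))‖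
        + ‖phase _ hc (magShift hb s (U t ψ₀)) - U t ψ₀‖ :=
        norm_sub_le_norm_sub_add_norm_sub _ _ _
    _ ≤ s * (√2 * ‖ζ‖) + s * (√2 * ‖ζ‖ + ‖aQ₁ b ⟨ψ₀, ha⟩‖) := by
        rw [← map_sub, LinearIsometry.norm_map, norm_sub_rev]
        exact add_le_add h1 h2
    _ = _ := by ring

/-- The lower growth condition on `a` turns a bound on `a(Q₁) ψ` into one on `Q₁ ψ`. -/
theorem IsUMF.exists_norm_Q₁_le (hb : IsUMF b) : ∃ R C : ℝ, ∀ (ψ : L2Plane) (K : ℝ), 0 ≤ K →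
    eLpNorm (fun x => (antideriv b x.1 : ℂ) * ψ x) 2 volume ≤ ENNReal.ofReal K →
    ∃ h : ψ ∈ Q₁.domain, ‖Q₁ ⟨ψ, h⟩‖ ≤ R * ‖ψ‖ + C * K := by
  obtain ⟨R, C, hR, hC, hRC⟩ := hb.exists_abs_le
  refine ⟨R, C, fun ψ K hK hψ => ?_⟩
  have hameas : AEStronglyMeasurable (fun x : ℝ × ℝ => (antideriv b x.1 : ℂ) * ψ x) volume :=
    (Complex.continuous_ofReal.comp hb.polyGrowth.continuous).aestronglyMeasurable.mul
      (Lp.aestronglyMeasurable ψ)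
  have hxmeas : AEStronglyMeasurable (fun x : ℝ × ℝ => (x.1 : ℂ) * ψ x) volume :=
    (Complex.continuous_ofReal.comp continuous_fst).aestronglyMeasurable.mul
      (Lp.aestronglyMeasurable ψ)
  have hle : eLpNorm (fun x : ℝ × ℝ => (x.1 : ℂ) * ψ x) 2 volume ≤
      ENNReal.ofReal (R * ‖ψ‖ + C * K) := by
    have h1 : eLpNorm (fun x : ℝ × ℝ => (x.1 : ℂ) * ψ x) 2 volume ≤
        eLpNorm (R • (fun x => ‖ψ x‖) + C • fun x => ‖(antideriv b x.1 : ℂ) * ψ x‖) 2 volume := by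
      refine eLpNorm_mono_real fun x => ?_
      simp only [Pi.add_apply, Pi.smul_apply, smul_eq_mul, norm_mul, Complex.norm_real,
        Real.norm_eq_abs]
      nlinarith [hRC x.1, norm_nonneg (ψ x)]
    refine h1.trans ((eLpNorm_add_le ((Lp.aestronglyMeasurable ψ).norm.const_smul R)
      (hameas.norm.const_smul C) one_le_two).trans ?_)
    rw [eLpNorm_const_smul, eLpNorm_const_smul, eLpNorm_norm, eLpNorm_norm, ← Lp.enorm_def,
      ENNReal.ofReal_add (by positivity) (by positivity), ENNReal.ofReal_mul hR,
      ENNReal.ofReal_mul hC, ofReal_norm, Real.enorm_of_nonneg hR, Real.enorm_of_nonneg hC]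
    gcongr
  have hmem : MemLp (fun x : ℝ × ℝ => (x.1 : ℂ) * ψ x) 2 volume :=
    ⟨hxmeas, hle.trans_lt ENNReal.ofReal_lt_top⟩
  refine ⟨hmem, ?_⟩
  change ‖hmem.toLp _‖ ≤ _
  rw [Lp.norm_toLp]
  exact ENNReal.toReal_le_of_le_ofReal (by positivity) hle

end Orbit

/-- If no non-negative self-adjoint square root exists, then the domain of `sqrtOp A` is `{0}`. -/
theorem isNonnegSqrt_sqrtOp {E : Type*} [NormedAddCommGroup E]
    [InnerProductSpace ℂ E] [CompleteSpace E] {A : E →ₗ.[ℂ] E} {ψ : E}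
    (hψ : ψ ∈ (sqrtOp A).domain) (h0 : ψ ≠ 0) : IsNonnegSqrt A (sqrtOp A) := by
  by_cases h : ∃ T : E →ₗ.[ℂ] E, IsNonnegSqrt A T
  · rw [sqrtOp, dif_pos h]
    exact h.choose_spec
  · rw [sqrtOp, dif_neg h] at hψ
    exact absurd ((Submodule.mem_bot ℂ).1 hψ) h0

theorem isUnitaryGroupOf_unitaryGroup {E : Type*} [NormedAddCommGroup E]
    [InnerProductSpace ℂ E] [CompleteSpace E] {A T : E →ₗ.[ℂ] E} (h : IsNonnegSqrt A T) :
    IsUnitaryGroupOf A (unitaryGroup A) := by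
  rw [unitaryGroup, dif_pos h.exists_isUnitaryGroupOf]
  exact h.exists_isUnitaryGroupOf.choose_spec

end MagneticField

/-- Dynamical localisation along the `x₁`-direction. -/
theorem theorem2p2 (b : ℝ → ℝ) (hb : MagneticField.IsUMF b)
    (ψ₀ : MagneticField.L2Plane) (hψ₀ : ‖ψ₀‖ = 1)
    (hH : ψ₀ ∈ (MagneticField.sqrtOp (MagneticField.hamiltonian b)).domain)
    (hQ : ψ₀ ∈ MagneticField.Q₁.domain)
    (ha : ψ₀ ∈ (MagneticField.aQ₁ b).domain) :
    ∃ hdom : ∀ t : ℝ, MagneticField.evolve b t ψ₀ ∈ MagneticField.Q₁.domain,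
      BddAbove (Set.range fun t : ℝ =>
        ‖MagneticField.Q₁ ⟨MagneticField.evolve b t ψ₀, hdom t⟩‖) := by
  have hψ : ψ₀ ≠ 0 := norm_ne_zero_iff.1 (hψ₀ ▸ one_ne_zero)
  have hT := MagneticField.isNonnegSqrt_sqrtOp hH hψ
  have hU := MagneticField.isUnitaryGroupOf_unitaryGroup hT
  have hgraph := LinearPMap.mem_graph _ (⟨ψ₀, hH⟩ :
    (MagneticField.sqrtOp (MagneticField.hamiltonian b)).domain)
  obtain ⟨R, C, hRC⟩ := hb.exists_norm_Q₁_le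
  choose hdom hbound using fun t : ℝ => hRC (MagneticField.evolve b t ψ₀) _ (by positivity)
    (MagneticField.eLpNorm_antideriv_mul_orbit_le hb hT hU hgraph ha t)
  have hnorm : ∀ t : ℝ, ‖MagneticField.evolve b t ψ₀‖ = ‖ψ₀‖ := fun t =>
    LinearIsometryEquiv.norm_map _ _
  simp only [hnorm] at hbound
  exact ⟨hdom, _, Set.forall_mem_range.2 hbound⟩
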